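/- Let $N\ge 1$, $t_0\le T$, $\tau:=T-t_0$, and let $\mathbb{Q}_0$ be a probability measure on a filtered space, under which all expectations, variances and covariances are taken. Let $W_1,\dots,W_N$ be Brownian motions on $[t_0,\infty)$ relative to one common filtration, with constant instantaneous correlations $\mathrm{d}[W_i,W_j]_t=\rho_{i,j}\,\mathrm{d}t$, where $[\cdot,\cdot]$ is the quadratic covariation. For $i=1,\dots,N$ let $\kappa_i,\xi_i>0$, let $\theta_i$ be a deterministic integrable function on $[t_0,T]$, and let the Hull–White spread $q_i$ be a continuous adapted solution of $$\mathrm{d}q_i(t)=\kappa_i\bigl(\theta_i(t)-q_i(t)\bigr)\,\mathrm{d}t+\xi_i\,\mathrm{d}W_i(t),\quad t\in(t_0,T],\qquad q_i(t_0)\in\mathbb{R}\ \text{deterministic}.$$ Write $\hat q_i(t):=\mathbb{E}[q_i(t)]$ for $t\in[t_0,T]$. Then the random variables $\int_{t_0}^T q_i(s)\,\mathrm{d}s$ are square-integrable, the functions $\hat q_i$ are integrable on $[t_0,T]$, and, for all $i,j\in\{1,\dots,N\}$, the product $\mathrm{e}^{-\int_{t_0}^T q_i(s)\,\mathrm{d}s}\,\mathrm{e}^{-\int_{t_0}^T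 q_j(s)\,\mathrm{d}s}$ is integrable and $$\mathbb{E}\Bigl[\mathrm{e}^{-\int_{t_0}^T q_i(s)\,\mathrm{d}s}\,\mathrm{e}^{-\int_{t_0}^T q_j(s)\,\mathrm{d}s}\Bigr]=\exp\Bigl(\mu_{i,j}+\tfrac12 v_{i,j}\Bigr),$$ where $$\mu_{i,j}:=-\mathbb{E}\Bigl[\int_{t_0}^T\bigl(q_i(s)+q_j(s)\bigr)\,\mathrm{d}s\Bigr]=-\int_{t_0}^T\bigl(\hat q_i(s)+\hat q_j(s)\bigr)\,\mathrm{d}s,$$ $$v_{i,j}:=\operatorname{Var}\Bigl[\int_{t_0}^T q_i(s)\,\mathrm{d}s\Bigr]+\operatorname{Var}\Bigl[\int_{t_0}^T q_j(s)\,\mathrm{d}s\Bigr]+2\operatorname{Cov}\Bigl[\int_{t_0}^T q_i(s)\,\mathrm{d}s,\int_{t_0}^T q_j(s)\,\mathrm{d}s\Bigr].$$ Furthermore, for all $i,j\in\{1,\dots,N\}$, $$\operatorname{Cov}\Bigl[\int_{t_0}^T q_i(s)\,\mathrm{d}s,\int_{t_0}^T q_j(s)\,\mathrm{d}s\Bigr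]=\frac{\xi_i\xi_j\rho_{i,j}}{\kappa_i+\kappa_j}\Biggl(\frac{\mathrm{e}^{-\kappa_j\tau}}{\kappa_j^2}-\frac1{\kappa_j^2}+\frac{\tau}{\kappa_j}+\frac{\mathrm{e}^{-\kappa_i\tau}}{\kappa_i^2}-\frac1{\kappa_i^2}+\frac{\tau}{\kappa_i}-\frac{\mathrm{e}^{-(\kappa_i+\kappa_j)\tau}}{\kappa_i\kappa_j}+\frac{\mathrm{e}^{-\kappa_i\tau}}{\kappa_i\kappa_j}+\frac{\mathrm{e}^{-\kappa_j\tau}}{\kappa_i\kappa_j}-\frac1{\kappa_i\kappa_j}\Biggr).$$ -/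

import Mathlib

open MeasureTheory ProbabilityTheory Filter Topology
open scoped NNReal

/-- `W` is a Brownian motion relative to the filtration `𝓕`, observed from the initial time `t₀` on:
it is adapted, its increments over `[s, t]` are independent of `𝓕 s`, and
`(W (t₀ + s) - W t₀)`, `s ≥ 0`, is a standard Brownian motion. -/
structure IsBrownianFrom {Ω : Type*} {mΩ : MeasurableSpace Ω} (P : Measure Ω)
    (𝓕 : Filtration ℝ mΩ) (t₀ : ℝ) (W : ℝ → Ω → ℝ) : Prop where
  isBrownian : IsBrownianReal (fun (s : ℝ≥0) ω ↦ W (t₀ + s) ω - W t₀ ω) P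
  adapted : ∀ t, t₀ ≤ t → StronglyMeasurable[𝓕 t] (W t)
  indep : ∀ s t, t₀ ≤ s → s ≤ t →
    Indep (MeasurableSpace.comap (fun ω ↦ W t ω - W s ω) inferInstance) (𝓕 s) P

/-- The quadratic covariation `[X, Y]` from the initial time `t₀` on is the process `A`: for every
`t ≥ t₀` and every sequence of partitions `t₀ = π n 0 ≤ π n 1 ≤ ⋯ ≤ π n (m n) = t` whose mesh tends
to zero, the sums of products of increments of `X` and `Y` converge to `A t` in probability. -/
def HasQuadCovariation {Ω : Type*} {mΩ : MeasurableSpace Ω} (P : Measure Ω) (t₀ : ℝ)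
    (X Y A : ℝ → Ω → ℝ) : Prop :=
  ∀ t, t₀ ≤ t → ∀ (m : ℕ → ℕ) (π : ℕ → ℕ → ℝ),
    (∀ n, Monotone (π n)) → (∀ n, π n 0 = t₀) → (∀ n, π n (m n) = t) →
    (∀ ε > 0, ∀ᶠ n in atTop, ∀ k < m n, π n (k + 1) - π n k < ε) →
    TendstoInMeasure P
      (fun n ω ↦ ∑ k ∈ Finset.range (m n),
        (X (π n (k + 1)) ω - X (π n k) ω) * (Y (π n (k + 1)) ω - Y (π n k) ω))
      atTop (A t)

/-- `q` is a (strong, continuous) solution on `[t₀, T]` of the one-factor Hull–White equation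
`dq(t) = κ (θ(t) - q(t)) dt + ξ dW(t)`, `q(t₀) = x₀`. Since `ξ` is constant, the stochastic integral
of `ξ` over `[t₀, t]` is `ξ (W(t) - W(t₀))`. -/
structure IsHullWhite {Ω : Type*} {mΩ : MeasurableSpace Ω} (P : Measure Ω)
    (𝓕 : Filtration ℝ mΩ) (t₀ T : ℝ) (κ ξ x₀ : ℝ) (θ : ℝ → ℝ) (W q : ℝ → Ω → ℝ) : Prop where
  adapted : ∀ t ∈ Set.Icc t₀ T, StronglyMeasurable[𝓕 t] (q t)
  continuousOn : ∀ᵐ ω ∂P, ContinuousOn (fun t ↦ q t ω) (Set.Icc t₀ T)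
  equation : ∀ᵐ ω ∂P, ∀ t ∈ Set.Icc t₀ T,
    q t ω = x₀ + (∫ s in t₀..t, κ * (θ s - q s ω)) + ξ * (W t ω - W t₀ ω)

/-- The pathwise time integral `∫_{t₀}^T q(s) ds` of a process. -/
noncomputable def timeIntegral {Ω : Type*} (t₀ T : ℝ) (q : ℝ → Ω → ℝ) (ω : Ω) : ℝ :=
  ∫ s in t₀..T, q s ω

/-- `μ = -E[∫_{t₀}^T (q(s) + q'(s)) ds]`. -/
noncomputable def mixedMean {Ω : Type*} {mΩ : MeasurableSpace Ω} (P : Measure Ω) (t₀ T : ℝ)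
    (q q' : ℝ → Ω → ℝ) : ℝ :=
  -∫ ω, (∫ s in t₀..T, (q s ω + q' s ω)) ∂P

/-- `v = Var[∫q] + Var[∫q'] + 2 Cov[∫q, ∫q']`, the integrals being over `[t₀, T]`. -/
noncomputable def mixedVar {Ω : Type*} {mΩ : MeasurableSpace Ω} (P : Measure Ω) (t₀ T : ℝ)
    (q q' : ℝ → Ω → ℝ) : ℝ :=
  variance (timeIntegral t₀ T q) P + variance (timeIntegral t₀ T q') P
    + 2 * covariance (timeIntegral t₀ T q) (timeIntegral t₀ T q') P

/-! The equation for $q_i$ is linear, so an integrating factor writes $\int q_i$ as a deterministic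
number plus $\int_{t_0}^T (W_i(u)-W_i(t_0))\,k_i(u)\,du$ with $k_i(u)=\xi_i e^{-\kappa_i(T-u)}$. The
exponential moment is then the Gaussian moment generating function at $-1$, provided the sum of two
such integrals is Gaussian. This is the real content: each $W_i$ is Gaussian, but joint Gaussianity
is not assumed, only a common filtration and $[W_i,W_j]_t=\rho_{i,j}(t-t_0)$.

Gaussianity is proved by a Lévy-type argument that needs no stochastic integral. Covariation sums
converge in probability and are bounded in $L^2$, hence converge in $L^1$; since increments over
disjoint intervals are conditionally uncorrelated, this gives the conditional covariance $\rho(t-s)$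
of two increments over $[s,t]$ (`HasQuadCovariation.integral_mul_sub_mul_sub`). A second-order
Taylor expansion of the characteristic function over a step $h$ then has error $O(h^{3/2})$
(`norm_integral_mul_exp_increment_sub_le`). Along a uniform partition these errors add up to
$O(h^{1/2})$, so left-point sums have a Gaussian limit (`tendsto_integral_exp_incrementSum`).
Pathwise summation by parts identifies their limit with the weighted time integrals
(`hasLaw_weightedIntegral_add`).

With $K_i(s)=\int_s^T k_i$, the sum has variance $\int(K_i^2+K_j^2+2\rho_{i,j}K_iK_j)$. Subtracting
the individual variances leaves the covariance $\rho_{i,j}\int K_iK_j$, an elementary integral of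
exponentials. -/

/-! ### Moments and independence of Brownian increments -/

/-- The absolute moment of order `k` of the standard normal distribution. -/
noncomputable def stdAbsMoment (k : ℕ) : ℝ := ∫ x, |x| ^ k ∂(gaussianReal 0 1)

lemma stdAbsMoment_nonneg (k : ℕ) : 0 ≤ stdAbsMoment k :=
  integral_nonneg fun _ ↦ by positivity

section Increments

variable {Ω : Type*} {mΩ : MeasurableSpace Ω} {P : Measure Ω} {𝓕 : Filtration ℝ mΩ} {t₀ : ℝ}
  {W : ℝ → Ω → ℝ} {s t : ℝ}

lemma IsBrownianFrom.hasLaw_sub (hW : IsBrownianFrom P 𝓕 t₀ W) (hs : t₀ ≤ s) (hst : s ≤ t) :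
    HasLaw (fun ω ↦ W t ω - W s ω) (gaussianReal 0 (t - s).toNNReal) P := by
  have h := hW.isBrownian.toIsPreBrownianReal.hasLaw_sub ⟨t - t₀, by linarith⟩ ⟨s - t₀, by linarith⟩
  convert! h using 1
  · ext ω
    change W t ω - W s ω
      = (W (t₀ + (t - t₀)) ω - W t₀ ω) - (W (t₀ + (s - t₀)) ω - W t₀ ω)
    simp
  · congr 1
    ext
    rw [coe_nndist, Real.coe_toNNReal _ (by linarith), Real.dist_eq]
    change t - s = |(t - t₀) - (s - t₀)|
    rw [abs_of_nonneg (by linarith)]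
    ring

lemma IsBrownianFrom.measurable (hW : IsBrownianFrom P 𝓕 t₀ W) (ht : t₀ ≤ t) : Measurable (W t) :=
  ((hW.adapted t ht).mono (𝓕.le t)).measurable

lemma IsBrownianFrom.memLp_sub (hW : IsBrownianFrom P 𝓕 t₀ W) (hs : t₀ ≤ s) (hst : s ≤ t)
    {p : ENNReal} (hp : p ≠ ⊤) : MemLp (fun ω ↦ W t ω - W s ω) p P := by
  have h := hW.hasLaw_sub hs hst
  have := memLp_id_gaussianReal' (μ := 0) (v := (t - s).toNNReal) p hp
  rw [← h.map_eq] at this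
  exact (memLp_map_measure_iff aestronglyMeasurable_id h.aemeasurable).1 this

lemma IsBrownianFrom.integrable_abs_sub_pow [IsProbabilityMeasure P]
    (hW : IsBrownianFrom P 𝓕 t₀ W) (hs : t₀ ≤ s) (hst : s ≤ t) (k : ℕ) :
    Integrable (fun ω ↦ |W t ω - W s ω| ^ k) P := by
  simpa using (hW.memLp_sub hs hst (p := k) (by simp)).integrable_norm_pow' 

lemma IsBrownianFrom.integral_abs_sub_pow (hW : IsBrownianFrom P 𝓕 t₀ W) (hs : t₀ ≤ s)
    (hst : s ≤ t) (k : ℕ) :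
    ∫ ω, |W t ω - W s ω| ^ k ∂P = √(t - s) ^ k * stdAbsMoment k := by
  have h := hW.hasLaw_sub hs hst
  have h1 : ∫ ω, |W t ω - W s ω| ^ k ∂P
      = ∫ x, |x| ^ k ∂(gaussianReal 0 (t - s).toNNReal) :=
    h.integral_comp (f := fun x : ℝ ↦ |x| ^ k) (by fun_prop)
  have h2 : gaussianReal 0 (t - s).toNNReal = (gaussianReal 0 1).map (√(t - s) * ·) := by
    rw [gaussianReal_map_const_mul]
    congr 1
    · simp
    · ext
      simp [Real.sq_sqrt (sub_nonneg.2 hst), sub_nonneg.2 hst]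
  rw [h1, h2, integral_map (by fun_prop) (by fun_prop), stdAbsMoment, ← integral_const_mul]
  simp_rw [abs_mul, mul_pow, abs_of_nonneg (Real.sqrt_nonneg _)]

lemma IsBrownianFrom.integral_sub (hW : IsBrownianFrom P 𝓕 t₀ W) (hs : t₀ ≤ s) (hst : s ≤ t) :
    ∫ ω, (W t ω - W s ω) ∂P = 0 := by
  rw [(hW.hasLaw_sub hs hst).integral_eq, integral_id_gaussianReal]

lemma IsBrownianFrom.integral_sub_sq (hW : IsBrownianFrom P 𝓕 t₀ W) (hs : t₀ ≤ s) (hst : s ≤ t) :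
    ∫ ω, (W t ω - W s ω) ^ 2 ∂P = t - s := by
  have h := (hW.hasLaw_sub hs hst)
  have h1 := h.variance_eq
  rw [variance_of_integral_eq_zero h.aemeasurable (hW.integral_sub hs hst),
    variance_id_gaussianReal, Real.coe_toNNReal _ (by linarith)] at h1
  exact h1

/-- Stands in for conditional expectations: with `f` the identity or the square it gives the
conditional mean and variance of an increment, tested against `Z`. -/
lemma IsBrownianFrom.integral_mul_comp_sub (hW : IsBrownianFrom P 𝓕 t₀ W) (hs : t₀ ≤ s)
    (hst : s ≤ t) {Z : Ω → ℂ} (hZ : StronglyMeasurable[𝓕 s] Z) {f : ℝ → ℂ} (hf : Measurable f) :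
    ∫ ω, Z ω * f (W t ω - W s ω) ∂P = (∫ ω, Z ω ∂P) * ∫ ω, f (W t ω - W s ω) ∂P := by
  have h1 : Measurable fun ω ↦ W t ω - W s ω :=
    (hW.measurable (hs.trans hst)).sub (hW.measurable hs)
  have h2 : IndepFun (fun ω ↦ W t ω - W s ω) Z P := by
    rw [IndepFun_iff_Indep]
    exact indep_of_indep_of_le_right (hW.indep s t hs hst) hZ.measurable.comap_le
  have h3 : IndepFun (fun ω ↦ f (W t ω - W s ω)) Z P := h2.comp hf measurable_id
  exact h3.symm.integral_fun_mul_eq_mul_integral (hZ.mono (𝓕.le s)).aestronglyMeasurable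
    (hf.comp h1).aestronglyMeasurable

end Increments

/-- A sequence that converges to `c` in probability and is bounded in `L²` around `c` converges
to `c` in `L¹`. -/
lemma tendsto_integral_abs_of_tendstoInMeasure {Ω : Type*} {mΩ : MeasurableSpace Ω} {P : Measure Ω}
    [IsProbabilityMeasure P] {f : ℕ → Ω → ℝ} {K : ℝ} (hf : ∀ n, MemLp (f n) 2 P)
    (hK : ∀ n, ∫ ω, f n ω ^ 2 ∂P ≤ K) (hlim : TendstoInMeasure P f atTop 0) :
    Tendsto (fun n ↦ ∫ ω, |f n ω| ∂P) atTop (𝓝 0) := by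
  have hK0 : 0 ≤ K := (integral_nonneg fun _ ↦ sq_nonneg _).trans (hK 0)
  rw [tendstoInMeasure_iff_measureReal_norm] at hlim
  -- Where $|f_n|<\varepsilon$ the bound is trivial; elsewhere $(\delta|f_n|-1)^2\ge 0$ gives
  -- $|f_n|\le\delta f_n^2+\delta^{-1}$.
  have key : ∀ ε > 0, ∀ δ > 0, ∀ n, ∫ ω, |f n ω| ∂P
      ≤ ε + (δ * K + P.real {ω | ε ≤ ‖f n ω - (0 : Ω → ℝ) ω‖} / δ) := by
    intro ε hε δ hδ n
    obtain ⟨g, hg, hfg⟩ := (hf n).1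
    have hS : MeasurableSet {ω | ε ≤ |g ω|} := measurableSet_le measurable_const hg.measurable.abs
    have hPS : P.real {ω | ε ≤ ‖f n ω - (0 : Ω → ℝ) ω‖} = P.real {ω | ε ≤ |g ω|} := by
      refine measureReal_congr ?_
      filter_upwards [hfg] with ω h
      change (ε ≤ ‖f n ω - 0‖) = (ε ≤ |g ω|)
      rw [sub_zero, Real.norm_eq_abs, h]
    have hint : Integrable ({ω | ε ≤ |g ω|}.indicator fun _ ↦ δ⁻¹) P :=
      (integrable_const _).indicator hS
    have hint2 : Integrable (fun ω ↦ δ * f n ω ^ 2) P := ((hf n).integrable_sq).const_mul _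
    have hint3 : Integrable (fun ω ↦ δ * f n ω ^ 2 +
        {ω | ε ≤ |g ω|}.indicator (fun _ ↦ δ⁻¹) ω) P := hint2.add hint
    calc ∫ ω, |f n ω| ∂P
        ≤ ∫ ω, (ε + (δ * f n ω ^ 2 + {ω | ε ≤ |g ω|}.indicator (fun _ ↦ δ⁻¹) ω)) ∂P := by
          refine integral_mono_ae ((hf n).integrable (by norm_num)).abs
            ((integrable_const _).add hint3) ?_
          filter_upwards [hfg] with ω h
          rw [h]
          by_cases hω : ε ≤ |g ω|
          · simp only [Set.indicator, Set.mem_ofPred_eq, hω, if_true]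
            have h1 : 0 ≤ (δ * |g ω| - 1) ^ 2 / δ := by positivity
            have h2 : (δ * |g ω| - 1) ^ 2 / δ = δ * g ω ^ 2 - 2 * |g ω| + δ⁻¹ := by
              rw [← sq_abs (g ω)]; field_simp; ring
            have := abs_nonneg (g ω)
            linarith
          · simp only [Set.indicator, Set.mem_ofPred_eq, hω, if_false]
            have : 0 ≤ δ * g ω ^ 2 := by positivity
            linarith
      _ = ε + (δ * ∫ ω, f n ω ^ 2 ∂P + P.real {ω | ε ≤ |g ω|} / δ) := by
          rw [integral_add (integrable_const _) hint3, integral_add hint2 hint,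
            integral_const_mul, integral_indicator_const _ hS]
          simp [div_eq_mul_inv]
      _ ≤ _ := by
          rw [hPS]
          gcongr
          exact hK n
  rw [Metric.tendsto_atTop]
  intro η hη
  -- The choice $\delta=\eta/(4(K+1))$ makes $\delta K\le\eta/4$; with $\delta$ fixed, the
  -- probability term still tends to zero.
  have h3 := (hlim (η / 4) (by positivity)).div_const (η / (4 * (K + 1)))
  rw [zero_div] at h3
  obtain ⟨N, hN⟩ := eventually_atTop.1 (h3.eventually_lt_const (show 0 < η / 4 by positivity))
  refine ⟨N, fun n hn ↦ ?_⟩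
  rw [Real.dist_eq, sub_zero, abs_of_nonneg (integral_nonneg fun _ ↦ abs_nonneg _)]
  refine (key (η / 4) (by positivity) (η / (4 * (K + 1))) (by positivity) n).trans_lt ?_
  have h4 : η / (4 * (K + 1)) * K ≤ η / 4 := by
    rw [div_mul_eq_mul_div, div_le_div_iff₀ (by positivity) (by positivity)]
    nlinarith
  linarith [hN n hn]

/-! ### Conditional covariance of the increments of two correlated Brownian motions -/

section Covariation

variable {Ω : Type*} {mΩ : MeasurableSpace Ω} {P : Measure Ω}
  {𝓕 : Filtration ℝ mΩ} {t₀ : ℝ} {X Y : ℝ → Ω → ℝ} {s t : ℝ}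

lemma TendstoInMeasure.sub_of_real [IsProbabilityMeasure P] {f g : ℕ → Ω → ℝ} {a b : Ω → ℝ}
    (hf : TendstoInMeasure P f atTop a) (hg : TendstoInMeasure P g atTop b) :
    TendstoInMeasure P (fun n ω ↦ f n ω - g n ω) atTop (fun ω ↦ a ω - b ω) := by
  rw [tendstoInMeasure_iff_measureReal_norm] at *
  intro ε hε
  have h := (hf (ε / 2) (by positivity)).add (hg (ε / 2) (by positivity))
  rw [add_zero] at h
  refine squeeze_zero (fun _ ↦ measureReal_nonneg) (fun n ↦ ?_) h
  refine (measureReal_mono ?_).trans (measureReal_union_le _ _)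
  intro ω hω
  simp only [Set.mem_ofPred_eq, Set.mem_union] at hω ⊢
  by_contra! hc
  have := norm_sub_le (f n ω - a ω) (g n ω - b ω)
  have h2 : f n ω - g n ω - (a ω - b ω) = f n ω - a ω - (g n ω - b ω) := by ring
  rw [h2] at hω
  linarith [hc.1, hc.2]

lemma integrable_bdd_mul_ofReal {Z : Ω → ℂ} (hZm : AEStronglyMeasurable Z P)
    (hZ : ∀ ω, ‖Z ω‖ ≤ 1) {f : Ω → ℝ} (hf : Integrable f P) :
    Integrable (fun ω ↦ Z ω * (f ω : ℂ)) P :=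
  hf.ofReal.bdd_mul hZm (ae_of_all _ hZ)

lemma norm_integral_mul_ofReal_le {Z : Ω → ℂ} (hZ : ∀ ω, ‖Z ω‖ ≤ 1) {f : Ω → ℝ}
    (hf : Integrable f P) : ‖∫ ω, Z ω * (f ω : ℂ) ∂P‖ ≤ ∫ ω, |f ω| ∂P := by
  refine (norm_integral_le_integral_norm _).trans
    (integral_mono_of_nonneg (ae_of_all _ fun _ ↦ norm_nonneg _) hf.abs (ae_of_all _ fun ω ↦ ?_))
  simp only [norm_mul, Complex.norm_real, Real.norm_eq_abs]
  exact mul_le_of_le_one_left (abs_nonneg _) (hZ ω)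

lemma IsBrownianFrom.integrable_sub_mul_sub (hX : IsBrownianFrom P 𝓕 t₀ X)
    (hY : IsBrownianFrom P 𝓕 t₀ Y) {u v : ℝ} (hs : t₀ ≤ s) (hst : s ≤ t) (hu : t₀ ≤ u)
    (huv : u ≤ v) : Integrable (fun ω ↦ (X t ω - X s ω) * (Y v ω - Y u ω)) P :=
  (hX.memLp_sub hs hst (p := 2) (by simp)).integrable_mul (hY.memLp_sub hu huv (p := 2) (by simp))

/-- The earlier increment times `Z` is `𝓕 u`-measurable, and the later one is centred and
independent of `𝓕 u`. The common filtration is essential here. -/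
lemma IsBrownianFrom.integral_cross_eq_zero (hX : IsBrownianFrom P 𝓕 t₀ X)
    (hY : IsBrownianFrom P 𝓕 t₀ Y) {u v : ℝ} (hs : t₀ ≤ s) (hsu : s ≤ u) (huv : u ≤ v)
    {Z : Ω → ℂ} (hZ : StronglyMeasurable[𝓕 s] Z) :
    ∫ ω, Z ω * (((X u ω - X s ω) * (Y v ω - Y u ω) : ℝ) : ℂ) ∂P = 0 := by
  have hm : StronglyMeasurable[𝓕 u] fun ω ↦ Z ω * ((X u ω - X s ω : ℝ) : ℂ) :=
    (hZ.mono (𝓕.mono hsu)).mul (Complex.continuous_ofReal.comp_stronglyMeasurable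
      ((hX.adapted u (hs.trans hsu)).sub ((hX.adapted s hs).mono (𝓕.mono hsu))))
  have h := hY.integral_mul_comp_sub (hs.trans hsu) huv hm (f := fun x ↦ (x : ℂ)) (by fun_prop)
  rw [integral_complex_ofReal, hY.integral_sub (hs.trans hsu) huv] at h
  simp only [Complex.ofReal_zero, mul_zero] at h
  rw [← h]
  refine integral_congr_ae (ae_of_all _ fun ω ↦ ?_)
  push_cast
  ring

lemma IsBrownianFrom.integral_sub_mul_sub_add (hX : IsBrownianFrom P 𝓕 t₀ X)
    (hY : IsBrownianFrom P 𝓕 t₀ Y) {u v : ℝ} (hs : t₀ ≤ s) (hsu : s ≤ u) (huv : u ≤ v)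
    {Z : Ω → ℂ} (hZ : StronglyMeasurable[𝓕 s] Z) (hZ1 : ∀ ω, ‖Z ω‖ ≤ 1) :
    ∫ ω, Z ω * (((X v ω - X s ω) * (Y v ω - Y s ω) : ℝ) : ℂ) ∂P
      = (∫ ω, Z ω * (((X u ω - X s ω) * (Y u ω - Y s ω) : ℝ) : ℂ) ∂P)
        + ∫ ω, Z ω * (((X v ω - X u ω) * (Y v ω - Y u ω) : ℝ) : ℂ) ∂P := by
  have hu := hs.trans hsu
  have hZm : AEStronglyMeasurable Z P := (hZ.mono (𝓕.le s)).aestronglyMeasurable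
  have i1 := integrable_bdd_mul_ofReal hZm hZ1 (hX.integrable_sub_mul_sub hY hs hsu hs hsu)
  have i2 := integrable_bdd_mul_ofReal hZm hZ1 (hX.integrable_sub_mul_sub hY hu huv hu huv)
  have i3 := integrable_bdd_mul_ofReal hZm hZ1 (hX.integrable_sub_mul_sub hY hs hsu hu huv)
  have i4 := integrable_bdd_mul_ofReal hZm hZ1 (hY.integrable_sub_mul_sub hX hs hsu hu huv)
  have e3 := hX.integral_cross_eq_zero hY hs hsu huv hZ
  have e4 := hY.integral_cross_eq_zero hX hs hsu huv hZ
  rw [← add_zero (_ + _), ← e3, ← add_zero (_ + _), ← e4, ← integral_add' i1 i2,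
    ← integral_add' (i1.add i2) i3, ← integral_add' ((i1.add i2).add i3) i4]
  refine integral_congr_ae (ae_of_all _ fun ω ↦ ?_)
  simp only [Pi.add_apply]
  push_cast
  ring

/-- Cross terms vanish, so refining the partition does not change the expectation: it is known once
the limit along fine partitions is known. -/
lemma IsBrownianFrom.integral_sum_sub_mul_sub (hX : IsBrownianFrom P 𝓕 t₀ X)
    (hY : IsBrownianFrom P 𝓕 t₀ Y) (hs : t₀ ≤ s) {Z : Ω → ℂ} (hZ : StronglyMeasurable[𝓕 s] Z)
    (hZ1 : ∀ ω, ‖Z ω‖ ≤ 1) {σ : ℕ → ℝ} (hσ : Monotone σ) (hσ0 : σ 0 = s) (n : ℕ) :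
    ∫ ω, Z ω * ((∑ k ∈ Finset.range n,
        (X (σ (k + 1)) ω - X (σ k) ω) * (Y (σ (k + 1)) ω - Y (σ k) ω) : ℝ) : ℂ) ∂P
      = ∫ ω, Z ω * (((X (σ n) ω - X s ω) * (Y (σ n) ω - Y s ω) : ℝ) : ℂ) ∂P := by
  have hZm : AEStronglyMeasurable Z P := (hZ.mono (𝓕.le s)).aestronglyMeasurable
  have hle : ∀ k, s ≤ σ k := fun k ↦ hσ0 ▸ hσ (Nat.zero_le k)
  have hi : ∀ k, Integrable
      (fun ω ↦ (X (σ (k + 1)) ω - X (σ k) ω) * (Y (σ (k + 1)) ω - Y (σ k) ω)) P := fun k ↦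
    hX.integrable_sub_mul_sub hY (hs.trans (hle k)) (hσ k.le_succ) (hs.trans (hle k))
      (hσ k.le_succ)
  induction n with
  | zero => simp [hσ0]
  | succ n ih =>
    rw [hX.integral_sub_mul_sub_add hY hs (hle n) (hσ n.le_succ) hZ hZ1, ← ih, ← integral_add]
    · refine integral_congr_ae (ae_of_all _ fun ω ↦ ?_)
      simp only [Finset.sum_range_succ]
      push_cast
      ring
    · exact integrable_bdd_mul_ofReal hZm hZ1 (integrable_finsetSum _ fun k _ ↦ hi k)
    · exact integrable_bdd_mul_ofReal hZm hZ1 (hi n)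

/-- The `k`-th point of the uniform partition of `[s, t]` into `n + 1` pieces. -/
noncomputable def uniformPoint (s t : ℝ) (n k : ℕ) : ℝ := s + (t - s) * (k / (n + 1))

lemma uniformPoint_mono (hst : s ≤ t) (n : ℕ) : Monotone (uniformPoint s t n) := by
  intro a b hab
  have : 0 ≤ t - s := sub_nonneg.2 hst
  unfold uniformPoint
  gcongr

@[simp] lemma uniformPoint_zero (n : ℕ) : uniformPoint s t n 0 = s := by simp [uniformPoint]

@[simp] lemma uniformPoint_last (n : ℕ) : uniformPoint s t n (n + 1) = t := by
  have : (n : ℝ) + 1 ≠ 0 := by positivity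
  simp [uniformPoint, div_self this]

lemma uniformPoint_succ_sub (n k : ℕ) :
    uniformPoint s t n (k + 1) - uniformPoint s t n k = (t - s) / (n + 1) := by
  unfold uniformPoint
  push_cast
  ring

lemma HasQuadCovariation.tendstoInMeasure_uniformPoint [IsProbabilityMeasure P] {ρ : ℝ}
    (hρ : HasQuadCovariation P t₀ X Y (fun t _ ↦ ρ * (t - t₀))) (hs : t₀ ≤ s) (hst : s ≤ t) :
    TendstoInMeasure P (fun n ω ↦ ∑ k ∈ Finset.range (n + 1),
      (X (uniformPoint s t n (k + 1)) ω - X (uniformPoint s t n k) ω)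
        * (Y (uniformPoint s t n (k + 1)) ω - Y (uniformPoint s t n k) ω))
      atTop (fun _ ↦ ρ * (t - s)) := by
  -- The covariation hypothesis concerns partitions starting at `t₀`. This one passes through `s` at
  -- index `n + 1` and reaches `t` at index `2 (n + 1)`, so the sum over `[s, t]` is a difference of
  -- two admissible sums. Points beyond `t` do not enter.
  set π : ℕ → ℕ → ℝ := fun n k ↦
    if k ≤ n + 1 then uniformPoint t₀ s n k else uniformPoint s t n (k - (n + 1)) with hπ
  have h1 : ∀ n k, k ≤ n + 1 → π n k = uniformPoint t₀ s n k := fun n k hk ↦ if_pos hk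
  have h2 : ∀ n k, π n (n + 1 + k) = uniformPoint s t n k := by
    intro n k
    rcases Nat.eq_zero_or_pos k with rfl | hk
    · rw [add_zero, h1 n _ le_rfl]
      simp
    · simp only [hπ]
      rw [if_neg (by omega), Nat.add_sub_cancel_left]
  have hinc : ∀ n k, π n (k + 1) - π n k = (s - t₀) / (n + 1) ∨
      π n (k + 1) - π n k = (t - s) / (n + 1) := by
    intro n k
    rcases Nat.lt_or_ge k (n + 1) with hk | hk
    · left
      rw [h1 n k hk.le, h1 n (k + 1) hk, uniformPoint_succ_sub]
    · right
      obtain ⟨l, rfl⟩ := Nat.exists_eq_add_of_le hk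
      rw [add_assoc, h2, h2, uniformPoint_succ_sub]
  have hmono : ∀ n, Monotone (π n) := by
    intro n
    refine monotone_nat_of_le_succ fun k ↦ ?_
    have a1 : 0 ≤ (s - t₀) / (n + 1 : ℝ) := div_nonneg (by linarith) (by positivity)
    have a2 : 0 ≤ (t - s) / (n + 1 : ℝ) := div_nonneg (by linarith) (by positivity)
    rcases hinc n k with h | h <;> linarith
  have hzero : ∀ n, π n 0 = t₀ := fun n ↦ by rw [h1 n 0 (Nat.zero_le _)]; simp
  have hmesh : ∀ ε > 0, ∀ᶠ n in atTop, ∀ k, π n (k + 1) - π n k < ε := by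
    intro ε hε
    have a1 : Tendsto (fun n : ℕ ↦ (s - t₀) / ((n : ℝ) + 1)) atTop (𝓝 0) :=
      tendsto_const_nhds.div_atTop (tendsto_atTop_add_const_right _ _ tendsto_natCast_atTop_atTop)
    have a2 : Tendsto (fun n : ℕ ↦ (t - s) / ((n : ℝ) + 1)) atTop (𝓝 0) :=
      tendsto_const_nhds.div_atTop (tendsto_atTop_add_const_right _ _ tendsto_natCast_atTop_atTop)
    filter_upwards [a1.eventually_lt_const hε, a2.eventually_lt_const hε] with n b1 b2 k
    rcases hinc n k with h | h <;> rw [h] <;> assumption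
  have hS := hρ s hs (fun n ↦ n + 1) π hmono hzero (fun n ↦ by rw [h1 n _ le_rfl]; simp)
    (fun ε hε ↦ (hmesh ε hε).mono fun n h k _ ↦ h k)
  have hT := hρ t (hs.trans hst) (fun n ↦ (n + 1) + (n + 1)) π hmono hzero
    (fun n ↦ by rw [h2 n]; simp) (fun ε hε ↦ (hmesh ε hε).mono fun n h k _ ↦ h k)
  refine (TendstoInMeasure.sub_of_real hT hS).congr (fun n ↦ ae_of_all _ fun ω ↦ ?_)
    (ae_of_all _ fun ω ↦ by ring)
  beta_reduce
  rw [Finset.sum_range_add, add_sub_cancel_left]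
  refine Finset.sum_congr rfl fun k _ ↦ ?_
  rw [add_assoc, h2, h2]

/-- Second moment bound for the sums of products of increments. -/
lemma IsBrownianFrom.memLp_sum_and_integral_sq_le [IsProbabilityMeasure P] (hX : IsBrownianFrom P 𝓕 t₀ X)
    (hY : IsBrownianFrom P 𝓕 t₀ Y) (hs : t₀ ≤ s) (hst : s ≤ t) (n : ℕ) :
    MemLp (fun ω ↦ ∑ k ∈ Finset.range (n + 1),
      (X (uniformPoint s t n (k + 1)) ω - X (uniformPoint s t n k) ω)
        * (Y (uniformPoint s t n (k + 1)) ω - Y (uniformPoint s t n k) ω)) 2 P ∧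
    ∫ ω, (∑ k ∈ Finset.range (n + 1),
      (X (uniformPoint s t n (k + 1)) ω - X (uniformPoint s t n k) ω)
        * (Y (uniformPoint s t n (k + 1)) ω - Y (uniformPoint s t n k) ω)) ^ 2 ∂P
      ≤ stdAbsMoment 4 * (t - s) ^ 2 := by
  set σ := uniformPoint s t n with hσ
  have hσm : Monotone σ := uniformPoint_mono hst n
  have hle : ∀ k, t₀ ≤ σ k := fun k ↦ hs.trans (by
    have := hσm (Nat.zero_le k); rwa [hσ, uniformPoint_zero] at this)
  have hst' : 0 ≤ t - s := sub_nonneg.2 hst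
  have : ENNReal.HolderTriple 4 4 2 := ⟨by
    rw [← two_mul, show (4 : ENNReal) = 2 * 2 by norm_num, ENNReal.mul_inv (by simp) (by simp),
      ← mul_assoc, ENNReal.mul_inv_cancel (by simp) (by simp), one_mul]⟩
  have hmem : ∀ k, MemLp (fun ω ↦ (X (σ (k + 1)) ω - X (σ k) ω) * (Y (σ (k + 1)) ω - Y (σ k) ω))
      2 P := fun k ↦
    MemLp.mul' (p := 4) (q := 4) (hY.memLp_sub (hle k) (hσm k.le_succ) (by simp))
      (hX.memLp_sub (hle k) (hσm k.le_succ) (by simp))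
  have hsum := memLp_finsetSum (Finset.range (n + 1)) fun k _ ↦ hmem k
  refine ⟨hsum, ?_⟩
  have h4 : ∀ V : ℝ → Ω → ℝ, IsBrownianFrom P 𝓕 t₀ V → ∀ k,
      Integrable (fun ω ↦ |V (σ (k + 1)) ω - V (σ k) ω| ^ 4) P ∧
      ∫ ω, |V (σ (k + 1)) ω - V (σ k) ω| ^ 4 ∂P = ((t - s) / (n + 1)) ^ 2 * stdAbsMoment 4 := by
    intro V hV k
    refine ⟨hV.integrable_abs_sub_pow (hle k) (hσm k.le_succ) 4, ?_⟩
    rw [hV.integral_abs_sub_pow (hle k) (hσm k.le_succ), hσ, uniformPoint_succ_sub,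
      show 4 = 2 * 2 from rfl, pow_mul, Real.sq_sqrt (by positivity)]
  have hterm : ∀ k, Integrable (fun ω ↦ |X (σ (k + 1)) ω - X (σ k) ω| ^ 4 / 2
      + |Y (σ (k + 1)) ω - Y (σ k) ω| ^ 4 / 2) P := fun k ↦
    ((h4 X hX k).1.div_const 2).add ((h4 Y hY k).1.div_const 2)
  have hint : Integrable (fun ω ↦ ((n : ℝ) + 1) * ∑ k ∈ Finset.range (n + 1),
      (|X (σ (k + 1)) ω - X (σ k) ω| ^ 4 / 2 + |Y (σ (k + 1)) ω - Y (σ k) ω| ^ 4 / 2)) P :=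
    (integrable_finsetSum _ fun k _ ↦ hterm k).const_mul _
  -- Cauchy–Schwarz costs a factor `n + 1` and there are `n + 1` terms; both are absorbed by the
  -- fourth moments, of order `((t - s) / (n + 1)) ^ 2`.
  refine (integral_mono hsum.integrable_sq hint fun ω ↦ ?_).trans_eq ?_
  · refine (sq_sum_le_card_mul_sum_sq).trans ?_
    rw [Finset.card_range]
    push_cast
    refine mul_le_mul_of_nonneg_left (Finset.sum_le_sum fun k _ ↦ ?_) (by positivity)
    generalize X (σ (k + 1)) ω - X (σ k) ω = a
    generalize Y (σ (k + 1)) ω - Y (σ k) ω = b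
    have e : ∀ x : ℝ, |x| ^ 4 = (x ^ 2) ^ 2 := fun x ↦ by
      rw [show 4 = 2 * 2 from rfl, pow_mul, sq_abs]
    rw [e, e, mul_pow]
    nlinarith [sq_nonneg (a ^ 2 - b ^ 2)]
  · rw [integral_const_mul, integral_finsetSum _ fun k _ ↦ hterm k]
    have : ∀ k, ∫ ω, (|X (σ (k + 1)) ω - X (σ k) ω| ^ 4 / 2
        + |Y (σ (k + 1)) ω - Y (σ k) ω| ^ 4 / 2) ∂P
        = ((t - s) / (n + 1)) ^ 2 * stdAbsMoment 4 := by
      intro k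
      rw [integral_add ((h4 X hX k).1.div_const 2) ((h4 Y hY k).1.div_const 2), integral_div,
        integral_div, (h4 X hX k).2, (h4 Y hY k).2]
      ring
    simp only [this, Finset.sum_const, Finset.card_range, nsmul_eq_mul]
    push_cast
    field_simp

/-- The conditional covariance of the increments over `[s, t]` given the past up to `s`. -/
theorem HasQuadCovariation.integral_mul_sub_mul_sub [IsProbabilityMeasure P] {ρ : ℝ}
    (hρ : HasQuadCovariation P t₀ X Y (fun t _ ↦ ρ * (t - t₀)))
    (hX : IsBrownianFrom P 𝓕 t₀ X) (hY : IsBrownianFrom P 𝓕 t₀ Y) (hs : t₀ ≤ s) (hst : s ≤ t)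
    {Z : Ω → ℂ} (hZ : StronglyMeasurable[𝓕 s] Z) (hZ1 : ∀ ω, ‖Z ω‖ ≤ 1) :
    ∫ ω, Z ω * (((X t ω - X s ω) * (Y t ω - Y s ω) : ℝ) : ℂ) ∂P
      = (∫ ω, Z ω ∂P) * ((ρ * (t - s) : ℝ) : ℂ) := by
  have hZm : AEStronglyMeasurable Z P := (hZ.mono (𝓕.le s)).aestronglyMeasurable
  set D : ℕ → Ω → ℝ := fun n ω ↦ ∑ k ∈ Finset.range (n + 1),
      (X (uniformPoint s t n (k + 1)) ω - X (uniformPoint s t n k) ω)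
        * (Y (uniformPoint s t n (k + 1)) ω - Y (uniformPoint s t n k) ω) with hD
  set c := ρ * (t - s) with hc
  have hmem : ∀ n, MemLp (D n) 2 P := fun n ↦ (hX.memLp_sum_and_integral_sq_le hY hs hst n).1
  have hmem' : ∀ n, MemLp (fun ω ↦ D n ω - c) 2 P := fun n ↦ (hmem n).sub (memLp_const c)
  have hbd : ∀ n, ∫ ω, (D n ω - c) ^ 2 ∂P ≤ 2 * (stdAbsMoment 4 * (t - s) ^ 2) + 2 * c ^ 2 := by
    intro n
    have hi : Integrable (fun ω ↦ 2 * D n ω ^ 2) P := (hmem n).integrable_sq.const_mul 2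
    refine (integral_mono (hmem' n).integrable_sq (hi.add (integrable_const (2 * c ^ 2)))
      fun ω ↦ ?_).trans ?_
    · simp only [Pi.add_apply]
      nlinarith [sq_nonneg (D n ω + c)]
    · simp only [Pi.add_apply]
      rw [integral_add hi (integrable_const _), integral_const_mul]
      simp only [integral_const, probReal_univ, one_smul]
      gcongr
      exact (hX.memLp_sum_and_integral_sq_le hY hs hst n).2
  have hlim : TendstoInMeasure P (fun n ω ↦ D n ω - c) atTop 0 := by
    have h := hρ.tendstoInMeasure_uniformPoint hs hst
    rw [tendstoInMeasure_iff_norm] at h ⊢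
    simpa only [Pi.zero_apply, sub_zero] using h
  have hL1 := tendsto_integral_abs_of_tendstoInMeasure hmem' hbd hlim
  have hint : ∀ n, Integrable (fun ω ↦ D n ω - c) P := fun n ↦ (hmem' n).integrable (by norm_num)
  -- The left side does not depend on `n`, while the right side tends to zero.
  have hle : ∀ n, ‖(∫ ω, Z ω * (((X t ω - X s ω) * (Y t ω - Y s ω) : ℝ) : ℂ) ∂P)
      - (∫ ω, Z ω ∂P) * (c : ℂ)‖ ≤ ∫ ω, |D n ω - c| ∂P := by
    intro n
    have e := hX.integral_sum_sub_mul_sub hY hs hZ hZ1 (uniformPoint_mono hst n)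
      (uniformPoint_zero n) (n + 1)
    rw [uniformPoint_last] at e
    rw [← e, ← integral_mul_const, ← MeasureTheory.integral_sub]
    · refine le_trans (le_of_eq ?_) (norm_integral_mul_ofReal_le hZ1 (hint n))
      congr 1
      refine integral_congr_ae (ae_of_all _ fun ω ↦ ?_)
      simp only [hD]
      push_cast
      ring
    · exact integrable_bdd_mul_ofReal hZm hZ1 ((hmem n).integrable (by norm_num))
    · exact integrable_bdd_mul_ofReal hZm hZ1 (integrable_const c)
  have h0 := ge_of_tendsto' hL1 hle
  exact sub_eq_zero.1 (norm_le_zero_iff.1 h0)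

end Covariation

/-! ### Characteristic functions of sums of increments -/

/-- For $|y|\le1$ this is the Taylor remainder; for $|y|>1$ the terms are bounded separately by
$2+|y|+y^2/2\le 4|y|^3$. A cubic bound for all `y` lets third moments control the error. -/
lemma norm_exp_I_mul_sub_taylor_two_le (y : ℝ) :
    ‖Complex.exp (Complex.I * y) - (1 + Complex.I * y - (y : ℂ) ^ 2 / 2)‖ ≤ 4 * |y| ^ 3 := by
  have hn : ‖Complex.I * (y : ℂ)‖ = |y| := by simp
  rcases le_or_gt |y| 1 with h | h
  · have h1 := Complex.exp_bound (x := Complex.I * y) (by rwa [hn]) (n := 3) (by norm_num)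
    rw [hn] at h1
    have e : ∑ m ∈ Finset.range 3, (Complex.I * (y : ℂ)) ^ m / (m.factorial : ℂ)
        = 1 + Complex.I * y - (y : ℂ) ^ 2 / 2 := by
      simp only [Finset.sum_range_succ, Finset.sum_range_zero, mul_pow, Nat.factorial]
      rw [Complex.I_sq]
      push_cast
      ring
    rw [e] at h1
    refine h1.trans ?_
    have : 0 ≤ |y| ^ 3 := by positivity
    norm_num [Nat.factorial]
    linarith
  · have h1 : ‖Complex.exp (Complex.I * y)‖ = 1 := by
      rw [mul_comm]; exact Complex.norm_exp_ofReal_mul_I y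
    have h2 : ‖(y : ℂ) ^ 2 / 2‖ = |y| ^ 2 / 2 := by simp
    have h3 := norm_sub_le (Complex.exp (Complex.I * y))
      (1 + Complex.I * y - (y : ℂ) ^ 2 / 2)
    have h4 := norm_sub_le (1 + Complex.I * y) ((y : ℂ) ^ 2 / 2)
    have h5 := norm_add_le (1 : ℂ) (Complex.I * y)
    rw [norm_one, hn] at h5
    rw [h2] at h4
    have h6 : |y| ≤ |y| ^ 2 := by nlinarith
    have h7 : |y| ^ 2 ≤ |y| ^ 3 := by nlinarith [sq_nonneg |y|]
    linarith

lemma Real.abs_exp_neg_sub_le (x : ℝ) : |Real.exp (-x) - (1 - x)| ≤ x ^ 2 * Real.exp |x| := by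
  have h := Complex.norm_exp_sub_sum_le_norm_mul_exp ((-x : ℝ) : ℂ) 2
  rw [← Complex.ofReal_exp] at h
  simp only [Finset.sum_range_succ, Finset.sum_range_zero, Nat.factorial] at h
  rw [Complex.norm_real, norm_neg, Real.norm_eq_abs, sq_abs] at h
  refine le_trans (le_of_eq ?_) h
  rw [← Real.norm_eq_abs, ← Complex.norm_real]
  congr 1
  push_cast
  ring

lemma add_pow_three_le {B a b p q : ℝ} (ha : |a| ≤ B) (hb : |b| ≤ B) :
    |a * p + b * q| ^ 3 ≤ 4 * B ^ 3 * (|p| ^ 3 + |q| ^ 3) := by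
  have hB : 0 ≤ B := (abs_nonneg a).trans ha
  have h1 : |a * p + b * q| ≤ B * (|p| + |q|) := by
    refine (abs_add_le _ _).trans ?_
    rw [abs_mul, abs_mul, mul_add]
    gcongr
  have hp := abs_nonneg p
  have hq := abs_nonneg q
  calc |a * p + b * q| ^ 3 ≤ (B * (|p| + |q|)) ^ 3 := by gcongr
    _ = B ^ 3 * (|p| + |q|) ^ 3 := by ring
    _ ≤ B ^ 3 * (4 * (|p| ^ 3 + |q| ^ 3)) := by
        gcongr
        -- $4(p^3+q^3)-(p+q)^3=3(p+q)(p-q)^2$.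
        nlinarith [mul_nonneg (add_nonneg hp hq) (sq_nonneg (|p| - |q|))]
    _ = _ := by ring

section OneStep

variable {Ω : Type*} {mΩ : MeasurableSpace Ω} {P : Measure Ω} [IsProbabilityMeasure P]
  {𝓕 : Filtration ℝ mΩ} {t₀ : ℝ} {X Y : ℝ → Ω → ℝ} {s t : ℝ} {ρ : ℝ}

/-- Over a short time step the pair of increments behaves, conditionally on the past, like a
Gaussian vector up to an error of order `3 / 2`. -/
lemma norm_integral_mul_exp_increment_sub_le {T : ℝ} (B : ℝ) (hB : 0 ≤ B)
    (hρ : HasQuadCovariation P t₀ X Y (fun t _ ↦ ρ * (t - t₀)))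
    (hX : IsBrownianFrom P 𝓕 t₀ X) (hY : IsBrownianFrom P 𝓕 t₀ Y) :
    ∃ C, 0 ≤ C ∧ ∀ s t, t₀ ≤ s → s ≤ t → t ≤ T → ∀ a b : ℝ, |a| ≤ B → |b| ≤ B →
      ∀ Z : Ω → ℂ, StronglyMeasurable[𝓕 s] Z → (∀ ω, ‖Z ω‖ ≤ 1) →
      ‖(∫ ω, Z ω * Complex.exp (Complex.I *
            ((a * (X t ω - X s ω) + b * (Y t ω - Y s ω) : ℝ) : ℂ)) ∂P)
        - (Real.exp (-((a ^ 2 + b ^ 2 + 2 * ρ * a * b) * (t - s) / 2)) : ℂ) * ∫ ω, Z ω ∂P‖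
        ≤ C * ((t - s) * √(t - s)) := by
  set M := B ^ 2 * (1 + |ρ|) with hM
  have hM0 : 0 ≤ M := by positivity
  set m := stdAbsMoment 3 with hm
  have hm0 : 0 ≤ m := stdAbsMoment_nonneg 3
  -- The first term is the Taylor error, $4\cdot 4B^3$ times two third moments. The second compares
  -- $e^{-x}$ with $1-x$ for $|x|\le Mh$, using $h^2\le\sqrt{T-t_0}\,h^{3/2}$.
  refine ⟨32 * B ^ 3 * m + M ^ 2 * √(T - t₀) * Real.exp (M * (T - t₀)), by positivity, ?_⟩
  intro s t hs hst htT a b ha hb Z hZ hZ1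
  have hZm : AEStronglyMeasurable Z P := (hZ.mono (𝓕.le s)).aestronglyMeasurable
  have hh : 0 ≤ t - s := sub_nonneg.2 hst
  set DX : Ω → ℝ := fun ω ↦ X t ω - X s ω with hDX
  set DY : Ω → ℝ := fun ω ↦ Y t ω - Y s ω with hDY
  set U : Ω → ℝ := fun ω ↦ a * DX ω + b * DY ω with hU
  set x := (a ^ 2 + b ^ 2 + 2 * ρ * a * b) * (t - s) / 2 with hx
  have iZ : Integrable Z P := Integrable.of_bound hZm 1 (ae_of_all _ hZ1)
  have i1X := integrable_bdd_mul_ofReal hZm hZ1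
    ((hX.memLp_sub hs hst (p := 2) (by simp)).integrable (by norm_num))
  have i1Y := integrable_bdd_mul_ofReal hZm hZ1
    ((hY.memLp_sub hs hst (p := 2) (by simp)).integrable (by norm_num))
  have i2X := integrable_bdd_mul_ofReal hZm hZ1
    (hX.memLp_sub hs hst (p := 2) (by simp)).integrable_sq
  have i2Y := integrable_bdd_mul_ofReal hZm hZ1
    (hY.memLp_sub hs hst (p := 2) (by simp)).integrable_sq
  have i2XY := integrable_bdd_mul_ofReal hZm hZ1 (hX.integrable_sub_mul_sub hY hs hst hs hst)
  have e1X : ∫ ω, Z ω * (DX ω : ℂ) ∂P = 0 := by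
    have h := hX.integral_mul_comp_sub hs hst hZ (f := fun x ↦ (x : ℂ)) (by fun_prop)
    rwa [integral_complex_ofReal, hX.integral_sub hs hst, Complex.ofReal_zero, mul_zero] at h
  have e1Y : ∫ ω, Z ω * (DY ω : ℂ) ∂P = 0 := by
    have h := hY.integral_mul_comp_sub hs hst hZ (f := fun x ↦ (x : ℂ)) (by fun_prop)
    rwa [integral_complex_ofReal, hY.integral_sub hs hst, Complex.ofReal_zero, mul_zero] at h
  have e2X : ∫ ω, Z ω * ((DX ω ^ 2 : ℝ) : ℂ) ∂P = (∫ ω, Z ω ∂P) * ((t - s : ℝ) : ℂ) := by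
    have h := hX.integral_mul_comp_sub hs hst hZ (f := fun x ↦ ((x ^ 2 : ℝ) : ℂ)) (by fun_prop)
    rwa [integral_complex_ofReal, hX.integral_sub_sq hs hst] at h
  have e2Y : ∫ ω, Z ω * ((DY ω ^ 2 : ℝ) : ℂ) ∂P = (∫ ω, Z ω ∂P) * ((t - s : ℝ) : ℂ) := by
    have h := hY.integral_mul_comp_sub hs hst hZ (f := fun x ↦ ((x ^ 2 : ℝ) : ℂ)) (by fun_prop)
    rwa [integral_complex_ofReal, hY.integral_sub_sq hs hst] at h
  have e2XY : ∫ ω, Z ω * ((DX ω * DY ω : ℝ) : ℂ) ∂P = (∫ ω, Z ω ∂P) * ((ρ * (t - s) : ℝ) : ℂ) :=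
    hρ.integral_mul_sub_mul_sub hX hY hs hst hZ hZ1
  -- `Z` times the second-order Taylor polynomial of $e^{iU}$, expanded into monomials whose
  -- expectations are now known.
  set Q : Ω → ℂ := fun ω ↦ Z ω + Complex.I * a * (Z ω * (DX ω : ℂ))
    + Complex.I * b * (Z ω * (DY ω : ℂ)) + (-(a : ℂ) ^ 2 / 2) * (Z ω * ((DX ω ^ 2 : ℝ) : ℂ))
    + (-(b : ℂ) ^ 2 / 2) * (Z ω * ((DY ω ^ 2 : ℝ) : ℂ))
    + (-(a : ℂ) * b) * (Z ω * ((DX ω * DY ω : ℝ) : ℂ)) with hQ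
  have j1 := iZ.add (i1X.const_mul (Complex.I * a))
  have j2 := j1.add (i1Y.const_mul (Complex.I * b))
  have j3 := j2.add (i2X.const_mul (-(a : ℂ) ^ 2 / 2))
  have j4 := j3.add (i2Y.const_mul (-(b : ℂ) ^ 2 / 2))
  have iQ : Integrable Q P := j4.add (i2XY.const_mul (-(a : ℂ) * b))
  have eQ : ∫ ω, Q ω ∂P = ((1 - x : ℝ) : ℂ) * ∫ ω, Z ω ∂P := by
    have : ∫ ω, Q ω ∂P = (∫ ω, Z ω ∂P) + Complex.I * a * (∫ ω, Z ω * (DX ω : ℂ) ∂P)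
        + Complex.I * b * (∫ ω, Z ω * (DY ω : ℂ) ∂P)
        + (-(a : ℂ) ^ 2 / 2) * (∫ ω, Z ω * ((DX ω ^ 2 : ℝ) : ℂ) ∂P)
        + (-(b : ℂ) ^ 2 / 2) * (∫ ω, Z ω * ((DY ω ^ 2 : ℝ) : ℂ) ∂P)
        + (-(a : ℂ) * b) * (∫ ω, Z ω * ((DX ω * DY ω : ℝ) : ℂ) ∂P) := by
      simp only [← integral_const_mul]
      rw [← integral_add' iZ (i1X.const_mul _), ← integral_add' j1 (i1Y.const_mul _),
        ← integral_add' j2 (i2X.const_mul _), ← integral_add' j3 (i2Y.const_mul _),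
        ← integral_add' j4 (i2XY.const_mul _)]
      rfl
    rw [this, e1X, e1Y, e2X, e2Y, e2XY, hx]
    push_cast
    ring
  have hUm : Measurable U :=
    (((hX.measurable (hs.trans hst)).sub (hX.measurable hs)).const_mul a).add
      (((hY.measurable (hs.trans hst)).sub (hY.measurable hs)).const_mul b)
  have iE : Integrable (fun ω ↦ Z ω * Complex.exp (Complex.I * (U ω : ℂ))) P := by
    refine Integrable.of_bound (hZm.mul ?_) 1 (ae_of_all _ fun ω ↦ ?_)
    · exact (by fun_prop : Measurable fun ω ↦
        Complex.exp (Complex.I * (U ω : ℂ))).aestronglyMeasurable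
    · rw [norm_mul, mul_comm Complex.I, Complex.norm_exp_ofReal_mul_I, mul_one]
      exact hZ1 ω
  have iX3 := hX.integrable_abs_sub_pow hs hst 3
  have iY3 := hY.integrable_abs_sub_pow hs hst 3
  have hR : ‖(∫ ω, Z ω * Complex.exp (Complex.I * (U ω : ℂ)) ∂P) - ∫ ω, Q ω ∂P‖
      ≤ 32 * B ^ 3 * m * ((t - s) * √(t - s)) := by
    rw [← MeasureTheory.integral_sub iE iQ]
    calc ‖∫ ω, (Z ω * Complex.exp (Complex.I * (U ω : ℂ)) - Q ω) ∂P‖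
        ≤ ∫ ω, ‖Z ω * Complex.exp (Complex.I * (U ω : ℂ)) - Q ω‖ ∂P :=
          norm_integral_le_integral_norm _
      _ ≤ ∫ ω, 16 * B ^ 3 * (|DX ω| ^ 3 + |DY ω| ^ 3) ∂P := by
          refine integral_mono (iE.sub iQ).norm ((iX3.add iY3).const_mul _) fun ω ↦ ?_
          have e : Z ω * Complex.exp (Complex.I * (U ω : ℂ)) - Q ω
              = Z ω * (Complex.exp (Complex.I * (U ω : ℂ))
                - (1 + Complex.I * (U ω : ℂ) - (U ω : ℂ) ^ 2 / 2)) := by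
            simp only [hQ, hU]
            push_cast
            ring
          beta_reduce
          rw [e, norm_mul]
          refine (mul_le_of_le_one_left (norm_nonneg _) (hZ1 ω)).trans ?_
          refine (norm_exp_I_mul_sub_taylor_two_le _).trans ?_
          have := add_pow_three_le (p := DX ω) (q := DY ω) ha hb
          linarith
      _ = 32 * B ^ 3 * m * ((t - s) * √(t - s)) := by
          rw [integral_const_mul, integral_add iX3 iY3, hX.integral_abs_sub_pow hs hst,
            hY.integral_abs_sub_pow hs hst, pow_succ (√(t - s)), Real.sq_sqrt hh]
          ring
  have hxM : |x| ≤ M * (t - s) := by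
    have h1 : |a ^ 2 + b ^ 2 + 2 * ρ * a * b| ≤ 2 * M := by
      have a1 : a ^ 2 ≤ B ^ 2 := sq_le_sq' (by linarith [(abs_le.1 ha).1]) (abs_le.1 ha).2
      have a2 : b ^ 2 ≤ B ^ 2 := sq_le_sq' (by linarith [(abs_le.1 hb).1]) (abs_le.1 hb).2
      have a3 : |2 * ρ * a * b| ≤ 2 * |ρ| * B * B := by
        rw [abs_mul, abs_mul, abs_mul, abs_two]
        gcongr
      refine (abs_add_le _ _).trans ?_
      rw [abs_of_nonneg (by positivity), hM]
      linarith
    rw [hx, abs_div, abs_mul, abs_of_nonneg hh, abs_two]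
    have := mul_le_mul_of_nonneg_right h1 hh
    linarith
  have hexp : |Real.exp (-x) - (1 - x)|
      ≤ M ^ 2 * √(T - t₀) * Real.exp (M * (T - t₀)) * ((t - s) * √(t - s)) := by
    have hsT : t - s ≤ T - t₀ := by linarith
    have h1 : x ^ 2 ≤ M ^ 2 * (√(T - t₀) * ((t - s) * √(t - s))) := by
      have a1 : x ^ 2 ≤ (M * (t - s)) ^ 2 := by
        rw [← sq_abs x]
        gcongr
      have a2 : √(t - s) * √(t - s) ≤ √(T - t₀) * √(t - s) := by gcongr
      rw [Real.mul_self_sqrt hh] at a2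
      have a3 := mul_le_mul_of_nonneg_left a2 hh
      calc x ^ 2 ≤ M ^ 2 * ((t - s) * (t - s)) := by linarith
        _ ≤ _ := by
          refine mul_le_mul_of_nonneg_left ?_ (by positivity)
          linarith
    have h2 : Real.exp |x| ≤ Real.exp (M * (T - t₀)) :=
      Real.exp_le_exp.2 (hxM.trans (by gcongr))
    calc |Real.exp (-x) - (1 - x)| ≤ x ^ 2 * Real.exp |x| := Real.abs_exp_neg_sub_le x
      _ ≤ (M ^ 2 * (√(T - t₀) * ((t - s) * √(t - s)))) * Real.exp (M * (T - t₀)) := by gcongr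
      _ = _ := by ring
  have hZint : ‖∫ ω, Z ω ∂P‖ ≤ 1 := by
    have := norm_integral_le_of_norm_le_const (μ := P) (ae_of_all _ hZ1)
    simpa using this
  have hsplit : (∫ ω, Z ω * Complex.exp (Complex.I * (U ω : ℂ)) ∂P)
      - (Real.exp (-x) : ℂ) * ∫ ω, Z ω ∂P
      = ((∫ ω, Z ω * Complex.exp (Complex.I * (U ω : ℂ)) ∂P) - ∫ ω, Q ω ∂P)
        - ((Real.exp (-x) - (1 - x) : ℝ) : ℂ) * ∫ ω, Z ω ∂P := by
    rw [eQ]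
    push_cast
    ring
  change ‖(∫ ω, Z ω * Complex.exp (Complex.I * (U ω : ℂ)) ∂P)
      - (Real.exp (-x) : ℂ) * ∫ ω, Z ω ∂P‖ ≤ _
  rw [hsplit]
  refine (norm_sub_le _ _).trans ?_
  rw [norm_mul, Complex.norm_real, Real.norm_eq_abs, add_mul]
  exact add_le_add hR ((mul_le_of_le_one_right (abs_nonneg _) hZint).trans hexp)

end OneStep

/-- Telescoping for an approximate recursion `E (k + 1) ≈ exp (-x k) * E k`. -/
lemma norm_mul_exp_sum_sub_le {E : ℕ → ℂ} {x : ℕ → ℝ} {ε A : ℝ} (n : ℕ)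
    (hE : ∀ k < n, ‖E (k + 1) - (Real.exp (-x k) : ℂ) * E k‖ ≤ ε)
    (hx : ∀ k ≤ n, ∑ j ∈ Finset.range k, x j ≤ A) :
    ‖E n * (Real.exp (∑ j ∈ Finset.range n, x j) : ℂ) - E 0‖ ≤ n * (Real.exp A * ε) := by
  induction n with
  | zero => simp
  | succ n ih =>
    have h1 := ih (fun k hk ↦ hE k (hk.trans n.lt_succ_self)) (fun k hk ↦ hx k (hk.trans n.le_succ))
    have h2 : E (n + 1) * (Real.exp (∑ j ∈ Finset.range (n + 1), x j) : ℂ) - E 0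
        = (E n * (Real.exp (∑ j ∈ Finset.range n, x j) : ℂ) - E 0)
          + (Real.exp (∑ j ∈ Finset.range (n + 1), x j) : ℂ)
            * (E (n + 1) - (Real.exp (-x n) : ℂ) * E n) := by
      have h3 : Real.exp (∑ j ∈ Finset.range n, x j)
          = Real.exp (∑ j ∈ Finset.range (n + 1), x j) * Real.exp (-x n) := by
        rw [← Real.exp_add, Finset.sum_range_succ]
        ring_nf
      rw [h3]
      push_cast
      ring
    rw [h2]
    refine (norm_add_le _ _).trans ?_
    rw [norm_mul, Complex.norm_real, Real.norm_eq_abs, Real.abs_exp]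
    have h4 : Real.exp (∑ j ∈ Finset.range (n + 1), x j)
        * ‖E (n + 1) - (Real.exp (-x n) : ℂ) * E n‖ ≤ Real.exp A * ε :=
      mul_le_mul (Real.exp_le_exp.2 (hx _ le_rfl)) (hE n n.lt_succ_self) (norm_nonneg _)
        (Real.exp_nonneg _)
    rw [Nat.cast_succ]
    linarith

/-- Riemann–Stieltjes type sums with arbitrary tags along the uniform partitions. -/
lemma tendsto_sum_tag_mul_integral {s t : ℝ} (hst : s ≤ t) {φ k : ℝ → ℝ}
    (hφ : ContinuousOn φ (Set.Icc s t)) (hk : Continuous k) {τ : ℕ → ℕ → ℝ}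
    (hτ : ∀ n j, τ n j ∈ Set.Icc (uniformPoint s t n j) (uniformPoint s t n (j + 1))) :
    Tendsto (fun n ↦ ∑ j ∈ Finset.range (n + 1),
        φ (τ n j) * ∫ u in uniformPoint s t n j..uniformPoint s t n (j + 1), k u)
      atTop (𝓝 (∫ u in s..t, φ u * k u)) := by
  have hunif := isCompact_Icc.uniformContinuousOn_of_continuous hφ
  rw [Metric.uniformContinuousOn_iff] at hunif
  rw [Metric.tendsto_atTop]
  intro ε hε
  set A := ∫ u in s..t, |k u| with hA
  have hA0 : 0 ≤ A := intervalIntegral.integral_nonneg hst fun _ _ ↦ abs_nonneg _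
  obtain ⟨δ, hδ, hδ'⟩ := hunif (ε / (A + 1)) (by positivity)
  have hmesh : Tendsto (fun n : ℕ ↦ (t - s) / ((n : ℝ) + 1)) atTop (𝓝 0) :=
    tendsto_const_nhds.div_atTop (tendsto_atTop_add_const_right _ _ tendsto_natCast_atTop_atTop)
  obtain ⟨N, hN⟩ := eventually_atTop.1 (hmesh.eventually_lt_const hδ)
  refine ⟨N, fun n hn ↦ ?_⟩
  set σ := uniformPoint s t n with hσ
  have hσm : Monotone σ := uniformPoint_mono hst n
  have hσ0 : σ 0 = s := uniformPoint_zero n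
  have hσn : σ (n + 1) = t := uniformPoint_last n
  have hmem : ∀ j ≤ n + 1, σ j ∈ Set.Icc s t := fun j hj ↦
    ⟨hσ0 ▸ hσm j.zero_le, hσn ▸ hσm hj⟩
  have hsub : ∀ j < n + 1, Set.Icc (σ j) (σ (j + 1)) ⊆ Set.Icc s t := fun j hj ↦
    Set.Icc_subset_Icc (hmem j hj.le).1 (hmem (j + 1) hj).2
  have hφk : ContinuousOn (fun u ↦ φ u * k u) (Set.Icc s t) := hφ.mul hk.continuousOn
  have hi : ∀ j < n + 1, IntervalIntegrable (fun u ↦ φ u * k u) volume (σ j) (σ (j + 1)) :=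
    fun j hj ↦ ContinuousOn.intervalIntegrable_of_Icc (hσm j.le_succ) (hφk.mono (hsub j hj))
  have e1 : ∫ u in s..t, φ u * k u
      = ∑ j ∈ Finset.range (n + 1), ∫ u in σ j..σ (j + 1), φ u * k u := by
    rw [intervalIntegral.sum_integral_adjacent_intervals hi, hσ0, hσn]
  have e2 : A = ∑ j ∈ Finset.range (n + 1), ∫ u in σ j..σ (j + 1), |k u| := by
    rw [intervalIntegral.sum_integral_adjacent_intervals
      fun j _ ↦ hk.abs.intervalIntegrable _ _, hσ0, hσn]
  have hterm : ∀ j ∈ Finset.range (n + 1),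
      ‖φ (τ n j) * (∫ u in σ j..σ (j + 1), k u) - ∫ u in σ j..σ (j + 1), φ u * k u‖
        ≤ ε / (A + 1) * ∫ u in σ j..σ (j + 1), |k u| := by
    intro j hj
    have hj' := Finset.mem_range.1 hj
    rw [← intervalIntegral.integral_const_mul, ← intervalIntegral.integral_sub
      ((hk.intervalIntegrable _ _).const_mul _) (hi j hj'), ← intervalIntegral.integral_const_mul]
    refine intervalIntegral.norm_integral_le_of_norm_le (hσm j.le_succ) (ae_of_all _ fun u hu ↦ ?_)
      ((hk.abs.intervalIntegrable _ _).const_mul _)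
    rw [← sub_mul, norm_mul, Real.norm_eq_abs (k u)]
    refine mul_le_mul_of_nonneg_right ?_ (abs_nonneg _)
    have hu' : u ∈ Set.Icc (σ j) (σ (j + 1)) := Set.Ioc_subset_Icc_self hu
    have hτj := hτ n j
    rw [← dist_eq_norm]
    refine (hδ' _ (hsub j hj' hτj) _ (hsub j hj' hu') ?_).le
    have hw : σ (j + 1) - σ j = (t - s) / (n + 1) := uniformPoint_succ_sub n j
    refine lt_of_le_of_lt ?_ (hN n hn)
    rw [← hw]
    exact Real.dist_le_of_mem_Icc hτj hu'
  rw [dist_eq_norm, e1, ← Finset.sum_sub_distrib]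
  refine (norm_sum_le_of_le _ hterm).trans_lt ?_
  rw [← Finset.mul_sum, ← e2, div_mul_eq_mul_div, div_lt_iff₀ (by positivity)]
  nlinarith

/-! ### Weighted time integrals of correlated Brownian motions are Gaussian -/

lemma tendsto_leftSum {t₀ T : ℝ} (hT : t₀ ≤ T) {q : ℝ → ℝ} (hq : Continuous q) :
    Tendsto (fun n : ℕ ↦ ∑ j ∈ Finset.range (n + 1),
        q (uniformPoint t₀ T n j) * ((T - t₀) / (n + 1))) atTop (𝓝 (∫ u in t₀..T, q u)) := by
  have h := tendsto_sum_tag_mul_integral hT (hq.continuousOn) (k := fun _ ↦ 1) continuous_const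
    (τ := fun n j ↦ uniformPoint t₀ T n j)
    fun n j ↦ ⟨le_rfl, uniformPoint_mono hT n j.le_succ⟩
  simpa only [intervalIntegral.integral_const, smul_eq_mul, mul_one, uniformPoint_succ_sub] using h

/-- Summation by parts: the left-point sums of `K dw` converge to `∫ w k`, if `-k` is the derivative
of `K`, and if `K` vanishes at the right and `w` at the left end of the interval. -/
lemma tendsto_leftSum_increment {t₀ T : ℝ} (hT : t₀ ≤ T) {w k : ℝ → ℝ}
    (hw : ContinuousOn w (Set.Icc t₀ T)) (hk : Continuous k) (hw0 : w t₀ = 0) :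
    Tendsto (fun n : ℕ ↦ ∑ j ∈ Finset.range (n + 1),
        (∫ u in uniformPoint t₀ T n j..T, k u)
          * (w (uniformPoint t₀ T n (j + 1)) - w (uniformPoint t₀ T n j)))
      atTop (𝓝 (∫ u in t₀..T, w u * k u)) := by
  have h := tendsto_sum_tag_mul_integral hT hw hk (τ := fun n j ↦ uniformPoint t₀ T n (j + 1))
    fun n j ↦ ⟨uniformPoint_mono hT n j.le_succ, le_rfl⟩
  refine h.congr fun n ↦ ?_
  set σ := uniformPoint t₀ T n with hσ
  set K : ℕ → ℝ := fun j ↦ ∫ u in σ j..T, k u with hK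
  have e1 : ∀ j, ∫ u in σ j..σ (j + 1), k u = K j - K (j + 1) := by
    intro j
    rw [hK, eq_sub_iff_add_eq]
    exact intervalIntegral.integral_add_adjacent_intervals (hk.intervalIntegrable _ _)
      (hk.intervalIntegrable _ _)
  have e2 := Finset.sum_range_sub (fun j ↦ K j * w (σ j)) (n + 1)
  have e3 : K (n + 1) = 0 := by simp [hK, hσ]
  have e4 : w (σ 0) = 0 := by rw [hσ, uniformPoint_zero, hw0]
  simp only [e3, e4, mul_zero, zero_mul, sub_zero] at e2
  rw [← sub_eq_zero, ← Finset.sum_sub_distrib, ← neg_eq_zero, ← e2, ← Finset.sum_neg_distrib]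
  refine Finset.sum_congr rfl fun j _ ↦ ?_
  rw [e1]
  ring

section Gaussian

variable {Ω : Type*} {mΩ : MeasurableSpace Ω} {P : Measure Ω}
  {𝓕 : Filtration ℝ mΩ} {t₀ T : ℝ} {X Y : ℝ → Ω → ℝ} {ρ : ℝ}

/-- The left-point sum with weights `f` and `g` along the first `m` increments of the
`n`-th uniform partition. -/
noncomputable def incrementSum (t₀ T : ℝ) (f g : ℝ → ℝ) (X Y : ℝ → Ω → ℝ) (n m : ℕ) (ω : Ω) : ℝ :=
  ∑ j ∈ Finset.range m,
    (f (uniformPoint t₀ T n j) * (X (uniformPoint t₀ T n (j + 1)) ω - X (uniformPoint t₀ T n j) ω)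
      + g (uniformPoint t₀ T n j)
        * (Y (uniformPoint t₀ T n (j + 1)) ω - Y (uniformPoint t₀ T n j) ω))

lemma stronglyMeasurable_incrementSum (hT : t₀ ≤ T) (hX : IsBrownianFrom P 𝓕 t₀ X)
    (hY : IsBrownianFrom P 𝓕 t₀ Y) (f g : ℝ → ℝ) (n m : ℕ) :
    StronglyMeasurable[𝓕 (uniformPoint t₀ T n m)] (incrementSum t₀ T f g X Y n m) := by
  have hm := uniformPoint_mono hT n
  have h0 : ∀ j, t₀ ≤ uniformPoint t₀ T n j := fun j ↦ by
    simpa using hm (Nat.zero_le j)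
  have had : ∀ V, IsBrownianFrom P 𝓕 t₀ V → ∀ j ≤ m,
      StronglyMeasurable[𝓕 (uniformPoint t₀ T n m)] (V (uniformPoint t₀ T n j)) := fun V hV j hj ↦
    (hV.adapted _ (h0 j)).mono (𝓕.mono (hm hj))
  unfold incrementSum
  refine Finset.stronglyMeasurable_fun_sum _ fun j hj ↦ ?_
  have hj' := Finset.mem_range.1 hj
  exact (((had X hX _ hj').sub (had X hX _ hj'.le)).const_mul _).add
    (((had Y hY _ hj').sub (had Y hY _ hj'.le)).const_mul _)

/-- With $q=f^2+g^2+2\rho fg$ and step $h$, each increment multiplies the characteristic function by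
$e^{-qh/2}$ up to $Ch^{3/2}$; the exponential of the partial sum serves as test variable `Z`. The
exponents form a Riemann sum of $q/2$. -/
lemma tendsto_integral_exp_incrementSum [IsProbabilityMeasure P] (hT : t₀ ≤ T)
    (hρ : HasQuadCovariation P t₀ X Y (fun t _ ↦ ρ * (t - t₀)))
    (hX : IsBrownianFrom P 𝓕 t₀ X) (hY : IsBrownianFrom P 𝓕 t₀ Y) {f g : ℝ → ℝ}
    (hf : Continuous f) (hg : Continuous g) :
    Tendsto (fun n ↦ ∫ ω, Complex.exp (Complex.I *
        (incrementSum t₀ T f g X Y n (n + 1) ω : ℂ)) ∂P) atTop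
      (𝓝 (Real.exp (-((∫ u in t₀..T, (f u ^ 2 + g u ^ 2 + 2 * ρ * f u * g u)) / 2)) : ℂ)) := by
  set q : ℝ → ℝ := fun u ↦ f u ^ 2 + g u ^ 2 + 2 * ρ * f u * g u with hq
  have hqc : Continuous q := by fun_prop
  obtain ⟨B₁, hB₁⟩ := isCompact_Icc.exists_bound_of_continuousOn
    (hf.continuousOn (s := Set.Icc t₀ T))
  obtain ⟨B₂, hB₂⟩ := isCompact_Icc.exists_bound_of_continuousOn
    (hg.continuousOn (s := Set.Icc t₀ T))
  obtain ⟨A, hA⟩ := isCompact_Icc.exists_bound_of_continuousOn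
    (hqc.continuousOn (s := Set.Icc t₀ T))
  have hA0 : 0 ≤ A := (norm_nonneg _).trans (hA t₀ ⟨le_rfl, hT⟩)
  have hB0 : 0 ≤ max B₁ B₂ := ((norm_nonneg _).trans (hB₁ t₀ ⟨le_rfl, hT⟩)).trans (le_max_left _ _)
  obtain ⟨C, hC0, hC⟩ := norm_integral_mul_exp_increment_sub_le (T := T) (max B₁ B₂) hB0 hρ hX hY
  have hL : 0 ≤ T - t₀ := sub_nonneg.2 hT
  set x : ℕ → ℕ → ℝ := fun n j ↦ q (uniformPoint t₀ T n j) * ((T - t₀) / (n + 1)) / 2 with hx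
  set E : ℕ → ℕ → ℂ := fun n m ↦ ∫ ω, Complex.exp (Complex.I *
        (incrementSum t₀ T f g X Y n m ω : ℂ)) ∂P with hE
  have hmem : ∀ n j, j ≤ n + 1 → uniformPoint t₀ T n j ∈ Set.Icc t₀ T := fun n j hj ↦
    ⟨by simpa using uniformPoint_mono hT n (Nat.zero_le j),
      by simpa using uniformPoint_mono hT n hj⟩
  have hstep : ∀ n, ∀ j < n + 1, ‖E n (j + 1) - (Real.exp (-x n j) : ℂ) * E n j‖
      ≤ C * ((T - t₀) / (n + 1) * √((T - t₀) / (n + 1))) := by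
    intro n j hj
    have hj0 := hmem n j hj.le
    have hj1 := hmem n (j + 1) hj
    have hZ : StronglyMeasurable[𝓕 (uniformPoint t₀ T n j)] fun ω ↦ Complex.exp (Complex.I *
        (incrementSum t₀ T f g X Y n j ω : ℂ)) :=
      (by fun_prop : Continuous fun y : ℝ ↦ Complex.exp (Complex.I * y)).comp_stronglyMeasurable
        (stronglyMeasurable_incrementSum hT hX hY f g n j)
    have h := hC (uniformPoint t₀ T n j) (uniformPoint t₀ T n (j + 1)) hj0.1
      (uniformPoint_mono hT n j.le_succ) hj1.2 (f (uniformPoint t₀ T n j))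
      (g (uniformPoint t₀ T n j)) ((hB₁ _ hj0).trans (le_max_left _ _))
      ((hB₂ _ hj0).trans (le_max_right _ _)) _ hZ
      (fun ω ↦ by rw [mul_comm, Complex.norm_exp_ofReal_mul_I])
    rw [uniformPoint_succ_sub] at h
    refine le_trans (le_of_eq ?_) h
    congr 2
    · simp only [hE]
      refine integral_congr_ae (ae_of_all _ fun ω ↦ ?_)
      simp only
      rw [← Complex.exp_add, ← mul_add, ← Complex.ofReal_add]
      congr 3
      rw [incrementSum, incrementSum, Finset.sum_range_succ]
  have hsumA : ∀ n, ∀ m ≤ n + 1, ∑ j ∈ Finset.range m, x n j ≤ A * (T - t₀) := by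
    intro n m hm
    have h1 : ∑ j ∈ Finset.range m, x n j ≤ ∑ j ∈ Finset.range m, A * ((T - t₀) / (n + 1)) := by
      refine Finset.sum_le_sum fun j hj ↦ ?_
      have h2 := (le_abs_self _).trans
        (hA _ (hmem n j ((Finset.mem_range.1 hj).le.trans hm)))
      have h3 : 0 ≤ (T - t₀) / (n + 1 : ℝ) := by positivity
      have h4 := mul_le_mul_of_nonneg_right h2 h3
      have h5 : 0 ≤ A * ((T - t₀) / (n + 1)) := by positivity
      simp only [hx]
      linarith
    refine h1.trans ?_
    rw [Finset.sum_const, Finset.card_range, nsmul_eq_mul]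
    have hm' : (m : ℝ) ≤ n + 1 := by exact_mod_cast hm
    calc (m : ℝ) * (A * ((T - t₀) / (n + 1))) ≤ (n + 1) * (A * ((T - t₀) / (n + 1))) := by gcongr
      _ = A * (T - t₀) := by field_simp
  have hkey : ∀ n, ‖E n (n + 1) * (Real.exp (∑ j ∈ Finset.range (n + 1), x n j) : ℂ) - 1‖
      ≤ Real.exp (A * (T - t₀)) * C * (T - t₀) * √((T - t₀) / (n + 1)) := by
    intro n
    have h := norm_mul_exp_sum_sub_le (n + 1) (hstep n) (hsumA n)
    have h0 : E n 0 = 1 := by simp [hE, incrementSum]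
    rw [h0] at h
    refine h.trans_eq ?_
    push_cast
    field_simp
  have hlim1 : Tendsto
      (fun n ↦ E n (n + 1) * (Real.exp (∑ j ∈ Finset.range (n + 1), x n j) : ℂ)) atTop (𝓝 1) := by
    rw [tendsto_iff_norm_sub_tendsto_zero]
    refine squeeze_zero (fun _ ↦ norm_nonneg _) hkey ?_
    have a1 : Tendsto (fun n : ℕ ↦ (T - t₀) / ((n : ℝ) + 1)) atTop (𝓝 0) :=
      tendsto_const_nhds.div_atTop (tendsto_atTop_add_const_right _ _ tendsto_natCast_atTop_atTop)
    have a2 := (Real.continuous_sqrt.tendsto 0).comp a1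
    rw [Real.sqrt_zero] at a2
    simpa using a2.const_mul (Real.exp (A * (T - t₀)) * C * (T - t₀))
  have hlim2 : Tendsto (fun n ↦ ∑ j ∈ Finset.range (n + 1), x n j) atTop
      (𝓝 ((∫ u in t₀..T, q u) / 2)) := by
    have := (tendsto_leftSum hT hqc).div_const 2
    simpa only [Finset.sum_div] using this
  have hlim3 : Tendsto (fun n ↦ (Real.exp (-∑ j ∈ Finset.range (n + 1), x n j) : ℂ)) atTop
      (𝓝 (Real.exp (-((∫ u in t₀..T, q u) / 2)) : ℂ)) :=
    (Complex.continuous_ofReal.tendsto _).comp ((Real.continuous_exp.tendsto _).comp hlim2.neg)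
  have := hlim1.mul hlim3
  rw [one_mul] at this
  refine this.congr fun n ↦ ?_
  rw [mul_assoc, ← Complex.ofReal_mul, ← Real.exp_add, add_neg_cancel, Real.exp_zero,
    Complex.ofReal_one, mul_one]

lemma IsBrownianFrom.ae_continuousOn (hX : IsBrownianFrom P 𝓕 t₀ X) :
    ∀ᵐ ω ∂P, ContinuousOn (fun u ↦ X u ω - X t₀ ω) (Set.Ici t₀) := by
  filter_upwards [hX.isBrownian.cont] with ω hω
  have h : ContinuousOn (fun u : ℝ ↦ X (t₀ + ((u - t₀).toNNReal : ℝ)) ω - X t₀ ω) (Set.Ici t₀) :=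
    (hω.comp (by fun_prop : Continuous fun u : ℝ ↦ (u - t₀).toNNReal)).continuousOn
  refine h.congr fun u hu ↦ ?_
  simp only
  rw [Real.coe_toNNReal _ (sub_nonneg.2 hu), add_sub_cancel]

/-- The weighted time integral `∫_{t₀}^T (X(u) - X(t₀)) k(u) du`. -/
noncomputable def weightedIntegral (t₀ T : ℝ) (k : ℝ → ℝ) (X : ℝ → Ω → ℝ) (ω : Ω) : ℝ :=
  ∫ u in t₀..T, (X u ω - X t₀ ω) * k u

/-- The weights are tail integrals of continuous functions, so summation by parts works path by path
and requires only continuity of the paths. -/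
lemma ae_tendsto_incrementSum (hT : t₀ ≤ T) (hX : IsBrownianFrom P 𝓕 t₀ X)
    (hY : IsBrownianFrom P 𝓕 t₀ Y) {k l : ℝ → ℝ} (hk : Continuous k) (hl : Continuous l) :
    ∀ᵐ ω ∂P, Tendsto (fun n ↦ incrementSum t₀ T (fun s ↦ ∫ u in s..T, k u)
        (fun s ↦ ∫ u in s..T, l u) X Y n (n + 1) ω) atTop
      (𝓝 (weightedIntegral t₀ T k X ω + weightedIntegral t₀ T l Y ω)) := by
  filter_upwards [hX.ae_continuousOn, hY.ae_continuousOn] with ω hXω hYω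
  have h1 := tendsto_leftSum_increment hT (hXω.mono Set.Icc_subset_Ici_self) hk (sub_self _)
  have h2 := tendsto_leftSum_increment hT (hYω.mono Set.Icc_subset_Ici_self) hl (sub_self _)
  refine (h1.add h2).congr fun n ↦ ?_
  simp only [incrementSum, sub_sub_sub_cancel_right, Finset.sum_add_distrib]

lemma aemeasurable_weightedIntegral_add (hT : t₀ ≤ T) (hX : IsBrownianFrom P 𝓕 t₀ X)
    (hY : IsBrownianFrom P 𝓕 t₀ Y) {k l : ℝ → ℝ} (hk : Continuous k) (hl : Continuous l) :
    AEMeasurable (fun ω ↦ weightedIntegral t₀ T k X ω + weightedIntegral t₀ T l Y ω) P :=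
  aemeasurable_of_tendsto_metrizable_ae atTop (fun n ↦
    ((stronglyMeasurable_incrementSum hT hX hY _ _ n (n + 1)).mono
      (𝓕.le _)).measurable.aemeasurable) (ae_tendsto_incrementSum hT hX hY hk hl)

lemma continuous_integral_left {k : ℝ → ℝ} (hk : Continuous k) (T : ℝ) :
    Continuous fun s ↦ ∫ u in s..T, k u := by
  simp_rw [intervalIntegral.integral_symm T]
  exact (intervalIntegral.continuous_primitive (fun _ _ ↦ hk.intervalIntegrable _ _) T).neg

/-- The variance of `∫ (X(u) - X(t₀)) k(u) du + ∫ (Y(u) - Y(t₀)) l(u) du`. -/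
noncomputable def weightedVariance (t₀ T ρ : ℝ) (k l : ℝ → ℝ) : ℝ :=
  ∫ s in t₀..T, ((∫ u in s..T, k u) ^ 2 + (∫ u in s..T, l u) ^ 2
    + 2 * ρ * (∫ u in s..T, k u) * ∫ u in s..T, l u)

lemma integral_exp_weightedIntegral [IsProbabilityMeasure P] (hT : t₀ ≤ T)
    (hρ : HasQuadCovariation P t₀ X Y (fun t _ ↦ ρ * (t - t₀)))
    (hX : IsBrownianFrom P 𝓕 t₀ X) (hY : IsBrownianFrom P 𝓕 t₀ Y) {k l : ℝ → ℝ}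
    (hk : Continuous k) (hl : Continuous l) :
    ∫ ω, Complex.exp (Complex.I *
        ((weightedIntegral t₀ T k X ω + weightedIntegral t₀ T l Y ω : ℝ) : ℂ)) ∂P
      = (Real.exp (-(weightedVariance t₀ T ρ k l / 2)) : ℂ) := by
  refine tendsto_nhds_unique (tendsto_integral_of_dominated_convergence (fun _ ↦ (1 : ℝ))
    (fun n ↦ ?_) (integrable_const _) (fun n ↦ ae_of_all _ fun ω ↦ ?_) ?_)
    (tendsto_integral_exp_incrementSum hT hρ hX hY (continuous_integral_left hk T)
      (continuous_integral_left hl T))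
  · exact ((by fun_prop : Continuous fun y : ℝ ↦ Complex.exp (Complex.I * y)).comp_stronglyMeasurable
      ((stronglyMeasurable_incrementSum hT hX hY _ _ n (n + 1)).mono
        (𝓕.le _))).aestronglyMeasurable
  · rw [mul_comm, Complex.norm_exp_ofReal_mul_I]
  · filter_upwards [ae_tendsto_incrementSum hT hX hY hk hl] with ω hω
    exact ((by fun_prop : Continuous fun y : ℝ ↦ Complex.exp (Complex.I * y)).tendsto _).comp hω

/-- A characteristic function has modulus at most one, so $e^{-v/2}\le1$; this avoids proving
$|\rho|\le1$. -/
lemma weightedVariance_nonneg [IsProbabilityMeasure P] (hT : t₀ ≤ T)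
    (hρ : HasQuadCovariation P t₀ X Y (fun t _ ↦ ρ * (t - t₀)))
    (hX : IsBrownianFrom P 𝓕 t₀ X) (hY : IsBrownianFrom P 𝓕 t₀ Y) {k l : ℝ → ℝ}
    (hk : Continuous k) (hl : Continuous l) : 0 ≤ weightedVariance t₀ T ρ k l := by
  have h1 : ‖∫ ω, Complex.exp (Complex.I *
      ((weightedIntegral t₀ T k X ω + weightedIntegral t₀ T l Y ω : ℝ) : ℂ)) ∂P‖ ≤ 1 := by
    refine (norm_integral_le_of_norm_le_const (C := 1) (ae_of_all _ fun ω ↦ ?_)).trans_eq (by simp)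
    rw [mul_comm, Complex.norm_exp_ofReal_mul_I]
  rw [integral_exp_weightedIntegral hT hρ hX hY hk hl, Complex.norm_real, Real.norm_eq_abs,
    Real.abs_exp, Real.exp_le_one_iff] at h1
  linarith

/-- The sum of weighted time integrals of two Brownian motions relative to a common filtration and
with constant correlation is a centred Gaussian variable. -/
theorem hasLaw_weightedIntegral_add [IsProbabilityMeasure P] (hT : t₀ ≤ T)
    (hρ : HasQuadCovariation P t₀ X Y (fun t _ ↦ ρ * (t - t₀)))
    (hX : IsBrownianFrom P 𝓕 t₀ X) (hY : IsBrownianFrom P 𝓕 t₀ Y) {k l : ℝ → ℝ}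
    (hk : Continuous k) (hl : Continuous l) :
    HasLaw (fun ω ↦ weightedIntegral t₀ T k X ω + weightedIntegral t₀ T l Y ω)
      (gaussianReal 0 (weightedVariance t₀ T ρ k l).toNNReal) P := by
  have hm := aemeasurable_weightedIntegral_add hT hX hY hk hl
  refine ⟨hm, ?_⟩
  have : IsProbabilityMeasure (P.map fun ω ↦
    weightedIntegral t₀ T k X ω + weightedIntegral t₀ T l Y ω) := Measure.isProbabilityMeasure_map hm
  refine Measure.ext_of_charFun (funext fun c ↦ ?_)
  rw [charFun_gaussianReal, charFun_apply_real, integral_map hm (by fun_prop),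
    Real.coe_toNNReal _ (weightedVariance_nonneg hT hρ hX hY hk hl)]
  -- Scaling both weights by `c` turns the value at one into the characteristic function at `c`.
  have h := integral_exp_weightedIntegral hT hρ hX hY (hk.const_mul c) (hl.const_mul c)
  have e1 : ∀ (V : ℝ → Ω → ℝ) (m : ℝ → ℝ) ω,
      weightedIntegral t₀ T (fun u ↦ c * m u) V ω = c * weightedIntegral t₀ T m V ω := by
    intro V m ω
    rw [weightedIntegral, weightedIntegral, ← intervalIntegral.integral_const_mul]
    congr 1
    ext u
    ring
  have e2 : weightedVariance t₀ T ρ (fun u ↦ c * k u) (fun u ↦ c * l u)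
      = c ^ 2 * weightedVariance t₀ T ρ k l := by
    rw [weightedVariance, weightedVariance, ← intervalIntegral.integral_const_mul]
    congr 1
    ext s
    simp only [intervalIntegral.integral_const_mul]
    ring
  simp only [e1, e2] at h
  have h3 : (Real.exp (-(c ^ 2 * weightedVariance t₀ T ρ k l / 2)) : ℂ)
      = Complex.exp (c * (0 : ℝ) * Complex.I - weightedVariance t₀ T ρ k l * c ^ 2 / 2) := by
    push_cast
    congr 1
    ring
  rw [← h3, ← h]
  refine integral_congr_ae (ae_of_all _ fun ω ↦ ?_)
  simp only
  congr 1
  push_cast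
  ring

end Gaussian

/-! ### Pathwise solution of the Hull–White equation -/

lemma hasDerivAt_integral_of_continuousOn {a b t : ℝ} {h : ℝ → ℝ}
    (hh : ContinuousOn h (Set.Icc a b)) (ht : t ∈ Set.Ioo a b) :
    HasDerivAt (fun u ↦ ∫ s in a..u, h s) (h t) t := by
  refine intervalIntegral.integral_hasDerivAt_right ?_ ?_ (hh.continuousAt (Icc_mem_nhds ht.1 ht.2))
  · exact (hh.mono (Set.Icc_subset_Icc_right ht.2.le)).intervalIntegrable_of_Icc ht.1.le
  · exact (hh.mono Set.Ioo_subset_Icc_self).stronglyMeasurableAtFilter isOpen_Ioo t ht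

lemma continuousOn_integral_of_continuousOn {a b : ℝ} (hab : a ≤ b) {h : ℝ → ℝ}
    (hh : ContinuousOn h (Set.Icc a b)) :
    ContinuousOn (fun u ↦ ∫ s in a..u, h s) (Set.Icc a b) := by
  have := intervalIntegral.continuousOn_primitive_interval (μ := volume) (a := a) (b := b)
    (by rw [Set.uIcc_of_le hab]; exact hh.integrableOn_Icc)
  rwa [Set.uIcc_of_le hab] at this

/-- If `q = g - κ ∫ q`, then `∫ q` is the convolution of `g` with the exponential kernel. -/
lemma integral_eq_of_add_mul_integral {a b κ : ℝ} (hab : a ≤ b) {q g : ℝ → ℝ}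
    (hq : ContinuousOn q (Set.Icc a b))
    (hg : ∀ t ∈ Set.Icc a b, q t + κ * (∫ s in a..t, q s) = g t) :
    ∫ s in a..b, q s = ∫ s in a..b, Real.exp (-κ * (b - s)) * g s := by
  have hI := continuousOn_integral_of_continuousOn hab hq
  have hgc : ContinuousOn g (Set.Icc a b) :=
    (hq.add (hI.const_mul κ)).congr fun t ht ↦ (hg t ht).symm
  -- Integrating factor: the derivative of $e^{-\kappa(b-t)}\int_a^t q$ is
  -- $e^{-\kappa(b-t)}(q+\kappa\int_a^t q)$.
  have h := intervalIntegral.integral_eq_sub_of_hasDerivAt_of_le hab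
    (f := fun t ↦ Real.exp (-κ * (b - t)) * ∫ s in a..t, q s)
    (f' := fun t ↦ Real.exp (-κ * (b - t)) * g t)
    ((by fun_prop : Continuous fun t ↦ Real.exp (-κ * (b - t))).continuousOn.mul hI)
    (fun t ht ↦ ?_)
    (((by fun_prop : Continuous fun t ↦ Real.exp (-κ * (b - t))).continuousOn.mul
      hgc).intervalIntegrable_of_Icc hab)
  · rw [h]
    simp
  · have h1 : HasDerivAt (fun t ↦ Real.exp (-κ * (b - t))) (Real.exp (-κ * (b - t)) * κ) t := by
      have := (((hasDerivAt_id t).const_sub b).const_mul (-κ)).exp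
      simpa using this
    convert! h1.mul (hasDerivAt_integral_of_continuousOn hq ht) using 1
    rw [← hg t (Set.Ioo_subset_Icc_self ht)]
    ring

/-- The deterministic forcing `x₀ + κ ∫_{t₀}^t θ`. -/
noncomputable def hullWhiteForcing (t₀ κ x₀ : ℝ) (θ : ℝ → ℝ) (t : ℝ) : ℝ :=
  x₀ + κ * ∫ s in t₀..t, θ s

/-- The mean of the time integral up to `t` of the Hull–White process. -/
noncomputable def hullWhiteIntegralMean (t₀ κ x₀ : ℝ) (θ : ℝ → ℝ) (t : ℝ) : ℝ :=
  ∫ s in t₀..t, Real.exp (-κ * (t - s)) * hullWhiteForcing t₀ κ x₀ θ s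

/-- The mean of the Hull–White process. -/
noncomputable def hullWhiteMean (t₀ κ x₀ : ℝ) (θ : ℝ → ℝ) (t : ℝ) : ℝ :=
  hullWhiteForcing t₀ κ x₀ θ t - κ * hullWhiteIntegralMean t₀ κ x₀ θ t

/-! ### Mean of the Hull–White process and of its time integral -/

section Deterministic

variable {t₀ T κ x₀ : ℝ} {θ : ℝ → ℝ}

lemma continuousOn_hullWhiteForcing (hT : t₀ ≤ T) (hθ : IntervalIntegrable θ volume t₀ T) :
    ContinuousOn (hullWhiteForcing t₀ κ x₀ θ) (Set.Icc t₀ T) := by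
  have := intervalIntegral.continuousOn_primitive_interval' hθ (Set.left_mem_uIcc)
  rw [Set.uIcc_of_le hT] at this
  exact continuousOn_const.add (this.const_mul κ)

/-- Takes `t` out of the integrand, so that the product rule and the fundamental theorem apply. -/
lemma hullWhiteIntegralMean_eq (t : ℝ) : hullWhiteIntegralMean t₀ κ x₀ θ t
    = Real.exp (-κ * t) * ∫ s in t₀..t, Real.exp (κ * s) * hullWhiteForcing t₀ κ x₀ θ s := by
  rw [hullWhiteIntegralMean, ← intervalIntegral.integral_const_mul]
  congr 1
  ext s
  rw [← mul_assoc, ← Real.exp_add]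
  ring_nf

lemma continuousOn_hullWhiteIntegralMean (hT : t₀ ≤ T) (hθ : IntervalIntegrable θ volume t₀ T) :
    ContinuousOn (hullWhiteIntegralMean t₀ κ x₀ θ) (Set.Icc t₀ T) := by
  rw [funext hullWhiteIntegralMean_eq]
  exact (by fun_prop : Continuous fun t ↦ Real.exp (-κ * t)).continuousOn.mul
    (continuousOn_integral_of_continuousOn hT
      ((by fun_prop : Continuous fun t ↦ Real.exp (κ * t)).continuousOn.mul
        (continuousOn_hullWhiteForcing hT hθ)))

lemma continuousOn_hullWhiteMean (hT : t₀ ≤ T) (hθ : IntervalIntegrable θ volume t₀ T) :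
    ContinuousOn (hullWhiteMean t₀ κ x₀ θ) (Set.Icc t₀ T) :=
  (continuousOn_hullWhiteForcing hT hθ).sub
    ((continuousOn_hullWhiteIntegralMean hT hθ).const_mul κ)

/-- The integral mean $m$ solves $m'=\text{forcing}-\kappa m$. Although `θ` is merely integrable,
the forcing is continuous, so $m$ is differentiable inside the interval. -/
lemma integral_hullWhiteMean (hT : t₀ ≤ T) (hθ : IntervalIntegrable θ volume t₀ T) :
    ∫ t in t₀..T, hullWhiteMean t₀ κ x₀ θ t = hullWhiteIntegralMean t₀ κ x₀ θ T := by
  have h := intervalIntegral.integral_eq_sub_of_hasDerivAt_of_le hT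
    (continuousOn_hullWhiteIntegralMean (κ := κ) (x₀ := x₀) hT hθ)
    (f' := hullWhiteMean t₀ κ x₀ θ) (fun t ht ↦ ?_)
    ((continuousOn_hullWhiteMean hT hθ).intervalIntegrable_of_Icc hT)
  · rw [h, hullWhiteIntegralMean_eq t₀]
    simp
  · have h1 : HasDerivAt (fun t ↦ Real.exp (-κ * t)) (Real.exp (-κ * t) * -κ) t := by
      have := ((hasDerivAt_id t).const_mul (-κ)).exp
      simpa using this
    have h2 := hasDerivAt_integral_of_continuousOn
      (h := fun s ↦ Real.exp (κ * s) * hullWhiteForcing t₀ κ x₀ θ s)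
      ((by fun_prop : Continuous fun t ↦ Real.exp (κ * t)).continuousOn.mul
        (continuousOn_hullWhiteForcing hT hθ)) ht
    rw [funext (hullWhiteIntegralMean_eq (t₀ := t₀) (κ := κ) (x₀ := x₀) (θ := θ))]
    convert! h1.mul h2 using 1
    have h3 : Real.exp (-κ * t) * Real.exp (κ * t) = 1 := by
      rw [← Real.exp_add, neg_mul, neg_add_cancel, Real.exp_zero]
    rw [hullWhiteMean, hullWhiteIntegralMean_eq, ← mul_assoc (Real.exp (-κ * t)) (Real.exp _), h3]
    ring

end Deterministic

/-- The weight with which the driving Brownian motion enters the time integral up to `t`. -/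
noncomputable def hullWhiteKernel (κ ξ t s : ℝ) : ℝ := ξ * Real.exp (-κ * (t - s))

lemma continuous_hullWhiteKernel (κ ξ t : ℝ) : Continuous (hullWhiteKernel κ ξ t) := by
  unfold hullWhiteKernel
  fun_prop

lemma integral_hullWhiteKernel {κ : ℝ} (hκ : κ ≠ 0) (ξ T s : ℝ) :
    ∫ u in s..T, hullWhiteKernel κ ξ T u = ξ * (1 - Real.exp (-κ * (T - s))) / κ := by
  rw [intervalIntegral.integral_eq_sub_of_hasDerivAt
    (f := fun u ↦ ξ * Real.exp (-κ * (T - u)) / κ) (fun u _ ↦ ?_)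
    ((continuous_hullWhiteKernel κ ξ T).intervalIntegrable _ _)]
  · simp
    ring
  · have := ((((hasDerivAt_id u).const_sub T).const_mul (-κ)).exp.const_mul ξ).div_const κ
    convert! this using 1
    simp [hullWhiteKernel]
    field_simp

lemma integral_mul_integral_hullWhiteKernel {κ κ' : ℝ} (hκ : 0 < κ) (hκ' : 0 < κ')
    (ξ ξ' t₀ T : ℝ) :
    ∫ s in t₀..T, (∫ u in s..T, hullWhiteKernel κ ξ T u) * ∫ u in s..T, hullWhiteKernel κ' ξ' T u
      = ξ * ξ' / (κ + κ') *
          (Real.exp (-κ' * (T - t₀)) / κ' ^ 2 - 1 / κ' ^ 2 + (T - t₀) / κ'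
            + Real.exp (-κ * (T - t₀)) / κ ^ 2 - 1 / κ ^ 2 + (T - t₀) / κ
            - Real.exp (-(κ + κ') * (T - t₀)) / (κ * κ') + Real.exp (-κ * (T - t₀)) / (κ * κ')
            + Real.exp (-κ' * (T - t₀)) / (κ * κ') - 1 / (κ * κ')) := by
  have hs : κ + κ' ≠ 0 := by positivity
  have hd : ∀ c : ℝ, c ≠ 0 → ∀ s, HasDerivAt (fun s ↦ Real.exp (-c * (T - s)) / c)
      (Real.exp (-c * (T - s))) s := by
    intro c hc s
    have := (((hasDerivAt_id s).const_sub T).const_mul (-c)).exp.div_const c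
    convert! this using 1
    simp [hc]
  simp_rw [integral_hullWhiteKernel hκ.ne', integral_hullWhiteKernel hκ'.ne']
  rw [intervalIntegral.integral_eq_sub_of_hasDerivAt
    -- Antiderivative of $\frac{\xi\xi'}{\kappa\kappa'}(1-e^{-\kappa(T-s)})(1-e^{-\kappa'(T-s)})$,
    -- expanded.
    (f := fun s ↦ ξ * ξ' / (κ * κ') * (s - Real.exp (-κ * (T - s)) / κ
      - Real.exp (-κ' * (T - s)) / κ' + Real.exp (-(κ + κ') * (T - s)) / (κ + κ'))) (fun s _ ↦ ?_)
    ((by fun_prop : Continuous _).intervalIntegrable _ _)]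
  · simp only [sub_self, mul_zero, Real.exp_zero]
    field_simp
    ring
  · have := ((((hasDerivAt_id s).sub (hd κ hκ.ne' s)).sub (hd κ' hκ'.ne' s)).add
      (hd (κ + κ') hs s)).const_mul (ξ * ξ' / (κ * κ'))
    convert! this using 1
    rw [show -(κ + κ') * (T - s) = -κ * (T - s) + -κ' * (T - s) by ring, Real.exp_add]
    field_simp
    ring

/-! ### Gaussian law of the time integrals -/

section HullWhite

variable {Ω : Type*} {mΩ : MeasurableSpace Ω} {P : Measure Ω}
  {𝓕 : Filtration ℝ mΩ} {t₀ T κ ξ x₀ : ℝ} {θ : ℝ → ℝ} {W q : ℝ → Ω → ℝ}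

/-- A path of the Hull–White process, in terms of its own time integral. -/
lemma IsHullWhite.ae_add_mul_timeIntegral (hq : IsHullWhite P 𝓕 t₀ T κ ξ x₀ θ W q)
    (hθ : IntervalIntegrable θ volume t₀ T) :
    ∀ᵐ ω ∂P, ∀ t ∈ Set.Icc t₀ T, q t ω + κ * timeIntegral t₀ t q ω
      = hullWhiteForcing t₀ κ x₀ θ t + ξ * (W t ω - W t₀ ω) := by
  filter_upwards [hq.continuousOn, hq.equation] with ω hc he t ht
  have hθt : IntervalIntegrable θ volume t₀ t :=
    hθ.mono_set (by
      rw [Set.uIcc_of_le ht.1, Set.uIcc_of_le (ht.1.trans ht.2)]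
      exact Set.Icc_subset_Icc_right ht.2)
  have hqt : IntervalIntegrable (fun s ↦ q s ω) volume t₀ t :=
    (hc.mono (Set.Icc_subset_Icc_right ht.2)).intervalIntegrable_of_Icc ht.1
  rw [he t ht, intervalIntegral.integral_const_mul, intervalIntegral.integral_sub hθt hqt,
    hullWhiteForcing, timeIntegral]
  ring

/-- The time integral of the Hull–White process as a deterministic term plus a weighted time
integral of the driving Brownian motion. -/
lemma IsHullWhite.ae_timeIntegral_eq (hq : IsHullWhite P 𝓕 t₀ T κ ξ x₀ θ W q)
    (hW : IsBrownianFrom P 𝓕 t₀ W) (hθ : IntervalIntegrable θ volume t₀ T) :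
    ∀ᵐ ω ∂P, ∀ t ∈ Set.Icc t₀ T, timeIntegral t₀ t q ω = hullWhiteIntegralMean t₀ κ x₀ θ t
      + weightedIntegral t₀ t (hullWhiteKernel κ ξ t) W ω := by
  filter_upwards [hq.continuousOn, hq.ae_add_mul_timeIntegral hθ, hW.ae_continuousOn]
    with ω hc he hw t ht
  have hsub : Set.Icc t₀ t ⊆ Set.Icc t₀ T := Set.Icc_subset_Icc_right ht.2
  have hexp : Continuous fun s ↦ Real.exp (-κ * (t - s)) := by fun_prop
  have h := integral_eq_of_add_mul_integral ht.1 (hc.mono hsub) fun s hs ↦ he s (hsub hs)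
  rw [timeIntegral, h, hullWhiteIntegralMean, weightedIntegral, ← intervalIntegral.integral_add]
  · congr 1
    ext s
    rw [hullWhiteKernel]
    ring
  · exact (hexp.continuousOn.mul
      ((continuousOn_hullWhiteForcing (ht.1.trans ht.2) hθ).mono hsub)).intervalIntegrable_of_Icc
        ht.1
  · exact ((hw.mono Set.Icc_subset_Ici_self).mul
      (continuous_hullWhiteKernel κ ξ t).continuousOn).intervalIntegrable_of_Icc ht.1

/-- The two-process result with both processes equal and second weight zero, which removes `ρ` from
the variance. -/
lemma hasLaw_weightedIntegral [IsProbabilityMeasure P] (hT : t₀ ≤ T) {ρ : ℝ}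
    (hρ : HasQuadCovariation P t₀ W W (fun t _ ↦ ρ * (t - t₀)))
    (hW : IsBrownianFrom P 𝓕 t₀ W) {k : ℝ → ℝ} (hk : Continuous k) :
    HasLaw (weightedIntegral t₀ T k W)
      (gaussianReal 0 (∫ s in t₀..T, (∫ u in s..T, k u) ^ 2).toNNReal) P := by
  have h := hasLaw_weightedIntegral_add hT hρ hW hW hk (l := fun _ ↦ 0) continuous_const
  have h0 : ∀ ω, weightedIntegral t₀ T (fun _ ↦ 0) W ω = 0 := fun ω ↦ by simp [weightedIntegral]
  simpa [weightedVariance, h0] using h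

/-- The equation gives $q(t)$ as forcing plus $\xi(W(t)-W(t_0))$ minus $\kappa\int_{t_0}^t q$; the
increment and the random part of the integral are both centred. -/
lemma IsHullWhite.integral_eq_hullWhiteMean [IsProbabilityMeasure P]
    (hq : IsHullWhite P 𝓕 t₀ T κ ξ x₀ θ W q) (hW : IsBrownianFrom P 𝓕 t₀ W) {ρ : ℝ}
    (hρ : HasQuadCovariation P t₀ W W (fun t _ ↦ ρ * (t - t₀)))
    (hθ : IntervalIntegrable θ volume t₀ T) {t : ℝ} (ht : t ∈ Set.Icc t₀ T) :
    ∫ ω, q t ω ∂P = hullWhiteMean t₀ κ x₀ θ t := by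
  have hlaw := hasLaw_weightedIntegral ht.1 hρ hW (continuous_hullWhiteKernel κ ξ t)
  have hV : Integrable (weightedIntegral t₀ t (hullWhiteKernel κ ξ t) W) P :=
    hlaw.hasGaussianLaw.integrable
  have hV0 : ∫ ω, weightedIntegral t₀ t (hullWhiteKernel κ ξ t) W ω ∂P = 0 := by
    rw [hlaw.integral_eq, integral_id_gaussianReal]
  have hw : Integrable (fun ω ↦ W t ω - W t₀ ω) P :=
    (hW.memLp_sub le_rfl ht.1 (p := 1) (by simp)).integrable le_rfl
  have h1 : q t =ᵐ[P] fun ω ↦ hullWhiteMean t₀ κ x₀ θ t + (ξ * (W t ω - W t₀ ω)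
      - κ * weightedIntegral t₀ t (hullWhiteKernel κ ξ t) W ω) := by
    filter_upwards [hq.ae_add_mul_timeIntegral hθ, hq.ae_timeIntegral_eq hW hθ] with ω h1 h2
    have h3 := h1 t ht
    rw [h2 t ht] at h3
    rw [hullWhiteMean]
    linarith
  have hi : Integrable (fun ω ↦ ξ * (W t ω - W t₀ ω)
      - κ * weightedIntegral t₀ t (hullWhiteKernel κ ξ t) W ω) P :=
    (hw.const_mul ξ).sub (hV.const_mul κ)
  rw [integral_congr_ae h1, integral_add (integrable_const _) hi, MeasureTheory.integral_sub (hw.const_mul ξ)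
    (hV.const_mul κ), integral_const_mul, integral_const_mul, hV0, hW.integral_sub le_rfl ht.1]
  simp

/-- The law of the sum of the time integrals of two Hull–White processes. -/
lemma IsHullWhite.hasLaw_timeIntegral_add [IsProbabilityMeasure P] {κ' ξ' x₀' : ℝ} {θ' : ℝ → ℝ}
    {W' q' : ℝ → Ω → ℝ} {ρ : ℝ} (hT : t₀ ≤ T) (hq : IsHullWhite P 𝓕 t₀ T κ ξ x₀ θ W q)
    (hq' : IsHullWhite P 𝓕 t₀ T κ' ξ' x₀' θ' W' q') (hW : IsBrownianFrom P 𝓕 t₀ W)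
    (hW' : IsBrownianFrom P 𝓕 t₀ W')
    (hρ : HasQuadCovariation P t₀ W W' (fun t _ ↦ ρ * (t - t₀)))
    (hθ : IntervalIntegrable θ volume t₀ T) (hθ' : IntervalIntegrable θ' volume t₀ T) :
    HasLaw (fun ω ↦ timeIntegral t₀ T q ω + timeIntegral t₀ T q' ω)
      (gaussianReal (hullWhiteIntegralMean t₀ κ x₀ θ T + hullWhiteIntegralMean t₀ κ' x₀' θ' T)
        (weightedVariance t₀ T ρ (hullWhiteKernel κ ξ T) (hullWhiteKernel κ' ξ' T)).toNNReal)
      P := by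
  have h := gaussianReal_const_add (hasLaw_weightedIntegral_add hT hρ hW hW'
    (continuous_hullWhiteKernel κ ξ T) (continuous_hullWhiteKernel κ' ξ' T))
    (hullWhiteIntegralMean t₀ κ x₀ θ T + hullWhiteIntegralMean t₀ κ' x₀' θ' T)
  rw [zero_add] at h
  refine h.congr ?_
  filter_upwards [hq.ae_timeIntegral_eq hW hθ, hq'.ae_timeIntegral_eq hW' hθ'] with ω h1 h2
  rw [h1 T ⟨hT, le_rfl⟩, h2 T ⟨hT, le_rfl⟩]
  ring

/-- The law of the time integral of a Hull–White process. -/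
lemma IsHullWhite.hasLaw_timeIntegral [IsProbabilityMeasure P] {ρ : ℝ} (hT : t₀ ≤ T)
    (hq : IsHullWhite P 𝓕 t₀ T κ ξ x₀ θ W q) (hW : IsBrownianFrom P 𝓕 t₀ W)
    (hρ : HasQuadCovariation P t₀ W W (fun t _ ↦ ρ * (t - t₀)))
    (hθ : IntervalIntegrable θ volume t₀ T) :
    HasLaw (timeIntegral t₀ T q) (gaussianReal (hullWhiteIntegralMean t₀ κ x₀ θ T)
      (∫ s in t₀..T, (∫ u in s..T, hullWhiteKernel κ ξ T u) ^ 2).toNNReal) P := by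
  have h := gaussianReal_const_add (hasLaw_weightedIntegral hT hρ hW
    (continuous_hullWhiteKernel κ ξ T)) (hullWhiteIntegralMean t₀ κ x₀ θ T)
  rw [zero_add] at h
  refine h.congr ?_
  filter_upwards [hq.ae_timeIntegral_eq hW hθ] with ω h1
  exact h1 T ⟨hT, le_rfl⟩

end HullWhite

/-- Mirrors the shape of `mixedVar`, so that the covariance can be read off by cancelling the
individual variances. -/
lemma weightedVariance_eq {t₀ T ρ : ℝ} {k l : ℝ → ℝ} (hk : Continuous k) (hl : Continuous l) :
    weightedVariance t₀ T ρ k l = (∫ s in t₀..T, (∫ u in s..T, k u) ^ 2)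
      + (∫ s in t₀..T, (∫ u in s..T, l u) ^ 2)
      + 2 * (ρ * ∫ s in t₀..T, (∫ u in s..T, k u) * ∫ u in s..T, l u) := by
  have hK := continuous_integral_left hk T
  have hL := continuous_integral_left hl T
  have i1 : IntervalIntegrable (fun s ↦ (∫ u in s..T, k u) ^ 2) volume t₀ T :=
    (hK.pow 2).intervalIntegrable _ _
  have i2 : IntervalIntegrable (fun s ↦ (∫ u in s..T, l u) ^ 2) volume t₀ T :=
    (hL.pow 2).intervalIntegrable _ _
  have i3 : IntervalIntegrable
      (fun s ↦ 2 * (ρ * ((∫ u in s..T, k u) * ∫ u in s..T, l u))) volume t₀ T :=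
    (((hK.mul hL).const_mul ρ).const_mul 2).intervalIntegrable _ _
  rw [weightedVariance, ← intervalIntegral.integral_const_mul,
    ← intervalIntegral.integral_const_mul, ← intervalIntegral.integral_add i1 i2,
    ← intervalIntegral.integral_add (i1.add i2) i3]
  congr 1
  ext s
  ring

/-! ### Mixed exponential moment and covariance -/

theorem mainTheorem3 {Ω : Type*} {mΩ : MeasurableSpace Ω} (P : Measure Ω) [IsProbabilityMeasure P]
    (𝓕 : Filtration ℝ mΩ) (N : ℕ) (t₀ T τ : ℝ) (hT : t₀ ≤ T) (hτ : τ = T - t₀)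
    (κ ξ x₀ : Fin N → ℝ) (hκ : ∀ i, 0 < κ i) (hξ : ∀ i, 0 < ξ i)
    (θ : Fin N → ℝ → ℝ) (hθ : ∀ i, IntervalIntegrable (θ i) volume t₀ T)
    (ρ : Fin N → Fin N → ℝ) (W q : Fin N → ℝ → Ω → ℝ)
    (hW : ∀ i, IsBrownianFrom P 𝓕 t₀ (W i))
    (hρ : ∀ i j, HasQuadCovariation P t₀ (W i) (W j) (fun t _ ↦ ρ i j * (t - t₀)))
    (hq : ∀ i, IsHullWhite P 𝓕 t₀ T (κ i) (ξ i) (x₀ i) (θ i) (W i) (q i))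
    (qhat : Fin N → ℝ → ℝ) (hqhat : ∀ i, ∀ t ∈ Set.Icc t₀ T, ∫ ω, q i t ω ∂P = qhat i t) :
    (∀ i, MemLp (timeIntegral t₀ T (q i)) 2 P ∧ IntervalIntegrable (qhat i) volume t₀ T) ∧
    ∀ i j,
      (Integrable
          (fun ω ↦ Real.exp (-timeIntegral t₀ T (q i) ω) * Real.exp (-timeIntegral t₀ T (q j) ω)) P ∧
        ∫ ω, Real.exp (-timeIntegral t₀ T (q i) ω) * Real.exp (-timeIntegral t₀ T (q j) ω) ∂P
          = Real.exp (mixedMean P t₀ T (q i) (q j) + 1 / 2 * mixedVar P t₀ T (q i) (q j))) ∧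
      mixedMean P t₀ T (q i) (q j) = -∫ s in t₀..T, (qhat i s + qhat j s) ∧
      covariance (timeIntegral t₀ T (q i)) (timeIntegral t₀ T (q j)) P
        = ξ i * ξ j * ρ i j / (κ i + κ j) *
          (Real.exp (-κ j * τ) / κ j ^ 2 - 1 / κ j ^ 2 + τ / κ j
            + Real.exp (-κ i * τ) / κ i ^ 2 - 1 / κ i ^ 2 + τ / κ i
            - Real.exp (-(κ i + κ j) * τ) / (κ i * κ j) + Real.exp (-κ i * τ) / (κ i * κ j)
            + Real.exp (-κ j * τ) / (κ i * κ j) - 1 / (κ i * κ j)) := by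
  have hlaw : ∀ i, HasLaw (timeIntegral t₀ T (q i)) (gaussianReal
      (hullWhiteIntegralMean t₀ (κ i) (x₀ i) (θ i) T)
      (∫ s in t₀..T, (∫ u in s..T, hullWhiteKernel (κ i) (ξ i) T u) ^ 2).toNNReal) P :=
    fun i ↦ (hq i).hasLaw_timeIntegral hT (hW i) (hρ i i) (hθ i)
  have hmem : ∀ i, MemLp (timeIntegral t₀ T (q i)) 2 P := fun i ↦
    (hlaw i).hasGaussianLaw.memLp_two
  -- The explicit mean supplies continuity of `qhat i`, and its known integral replaces an appeal to
  -- Fubini in the formula for $\mu_{i,j}$.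
  have hqm : ∀ i, ∀ t ∈ Set.Icc t₀ T, qhat i t = hullWhiteMean t₀ (κ i) (x₀ i) (θ i) t :=
    fun i t ht ↦ by
      rw [← hqhat i t ht, (hq i).integral_eq_hullWhiteMean (hW i) (hρ i i) (hθ i) ht]
  have hqc : ∀ i, ContinuousOn (qhat i) (Set.Icc t₀ T) := fun i ↦
    (continuousOn_hullWhiteMean hT (hθ i)).congr (hqm i)
  have hqi : ∀ i, IntervalIntegrable (qhat i) volume t₀ T := fun i ↦
    (hqc i).intervalIntegrable_of_Icc hT
  have hqint : ∀ i, ∫ s in t₀..T, qhat i s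
      = hullWhiteIntegralMean t₀ (κ i) (x₀ i) (θ i) T := fun i ↦ by
    rw [← integral_hullWhiteMean hT (hθ i)]
    refine intervalIntegral.integral_congr fun s hs ↦ hqm i s ?_
    rwa [Set.uIcc_of_le hT] at hs
  refine ⟨fun i ↦ ⟨hmem i, hqi i⟩, fun i j ↦ ?_⟩
  set v := weightedVariance t₀ T (ρ i j) (hullWhiteKernel (κ i) (ξ i) T)
    (hullWhiteKernel (κ j) (ξ j) T) with hv
  have hv0 : 0 ≤ v := weightedVariance_nonneg hT (hρ i j) (hW i) (hW j)
    (continuous_hullWhiteKernel _ _ _) (continuous_hullWhiteKernel _ _ _)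
  have hsum := (hq i).hasLaw_timeIntegral_add hT (hq j) (hW i) (hW j) (hρ i j) (hθ i) (hθ j)
  rw [← hv] at hsum
  have hvar : mixedVar P t₀ T (q i) (q j) = v := by
    have h1 := hsum.variance_eq
    rw [variance_fun_add (hmem i) (hmem j), variance_id_gaussianReal,
      Real.coe_toNNReal _ hv0] at h1
    rw [mixedVar]
    linarith
  have hmean : mixedMean P t₀ T (q i) (q j)
      = -(hullWhiteIntegralMean t₀ (κ i) (x₀ i) (θ i) T
        + hullWhiteIntegralMean t₀ (κ j) (x₀ j) (θ j) T) := by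
    have h1 := hsum.integral_eq
    rw [integral_id_gaussianReal] at h1
    rw [mixedMean, ← h1]
    congr 1
    refine integral_congr_ae ?_
    filter_upwards [(hq i).continuousOn, (hq j).continuousOn] with ω hi hj
    exact intervalIntegral.integral_add (hi.intervalIntegrable_of_Icc hT)
      (hj.intervalIntegrable_of_Icc hT)
  have hexp : (fun ω ↦ Real.exp (-timeIntegral t₀ T (q i) ω)
      * Real.exp (-timeIntegral t₀ T (q j) ω))
      = fun ω ↦ Real.exp (-1 * (timeIntegral t₀ T (q i) ω + timeIntegral t₀ T (q j) ω)) := by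
    ext ω
    rw [← Real.exp_add]
    ring_nf
  refine ⟨⟨?_, ?_⟩, ?_, ?_⟩
  · rw [hexp]
    have h1 := integrable_exp_mul_gaussianReal (μ := hullWhiteIntegralMean t₀ (κ i) (x₀ i) (θ i) T
        + hullWhiteIntegralMean t₀ (κ j) (x₀ j) (θ j) T) (v := v.toNNReal) (-1)
    rw [← hsum.map_eq] at h1
    exact h1.comp_aemeasurable hsum.aemeasurable
  -- At $-1$ the Gaussian moment generating function is $e^{-m+v/2}$, where $-m$ is `mixedMean`.
  · have h1 := mgf_gaussianReal hsum.map_eq (-1)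
    rw [mgf] at h1
    rw [hexp, h1, hmean, hvar, Real.coe_toNNReal _ hv0]
    congr 1
    ring
  · rw [hmean, intervalIntegral.integral_add (hqi i) (hqi j), hqint, hqint]
  · have hvar1 : ∀ l, variance (timeIntegral t₀ T (q l)) P
        = ∫ s in t₀..T, (∫ u in s..T, hullWhiteKernel (κ l) (ξ l) T u) ^ 2 := fun l ↦ by
      rw [(hlaw l).variance_eq, variance_id_gaussianReal, Real.coe_toNNReal]
      exact intervalIntegral.integral_nonneg hT fun _ _ ↦ sq_nonneg _
    -- Polarization: the variance of the sum is expanded in two ways and the individual variances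
    -- cancel.
    have h1 := weightedVariance_eq (t₀ := t₀) (T := T) (ρ := ρ i j)
      (continuous_hullWhiteKernel (κ i) (ξ i) T) (continuous_hullWhiteKernel (κ j) (ξ j) T)
    rw [← hv, ← hvar, mixedVar, hvar1, hvar1,
      integral_mul_integral_hullWhiteKernel (hκ i) (hκ j)] at h1
    rw [← hτ] at h1
    refine (mul_left_cancel₀ two_ne_zero (add_left_cancel h1)).trans ?_
    rw [mul_div_right_comm (ξ i * ξ j), mul_comm _ (ρ i j), mul_assoc]
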